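/- Let $K$ be a field and let $E=(E^0,E^1,r,s)$ be a row-finite directed graph, i.e. every vertex emits only finitely many edges ($E^0$ and $E^1$ may be infinite). Let $H\subseteq E^0$ be a finite hereditary set of vertices (if $s(e)\in H$ then $r(e)\in H$), and let $\overline H$ be its hereditary saturated closure, i.e. the smallest set of vertices containing $H$ that is hereditary and saturated (it contains every vertex $v$ that emits at least one edge and all of whose edges have range in it). Let $E_H$ be the restriction graph with vertex set $H$ and edge set $\{e\in E^1 : s(e)\in H\}$, and let $E/\overline H$ be the quotient graph with vertex set $E^0\setminus\overline H$ and edge set $\{e\in E^1 : r(e)\notin\overline H\}$. For a graph $F$ let $L_K(F)$ be its Leavitt path algebra: the (not necessarily unital) associative $K$-algebra generated by the vertices $v$, the edges $e$ and the ghost edges $e^*$ of $F$ subject to $vw=\delta_{v,w}v$; $s(e)e=e=e\,r(e)$; $r(e)e^*=e^*=e^*s(e)$; $e^*f=\delta_{e,f}\,r(e)$; and $v=\sum_{s(e)=v}ee^*$ for every vertex $v$ that emits at least one and only finitely many edges. Let $L_K(F)\text{-Mod}$ be the abelian category of unital left $L_K(F)$-modules, i.e. left modules $M$ with $L_K(F)M=M$.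 Then there is a recollement of abelian categories with $\mathscr A=L_K(E/\overline H)\text{-Mod}$ on the left, $\mathscr B=L_K(E)\text{-Mod}$ in the middle and $\mathscr C=L_K(E_H)\text{-Mod}$ on the right. That is, there are functors $i:\mathscr A\to\mathscr B$, $q,p:\mathscr B\to\mathscr A$, $j:\mathscr B\to\mathscr C$ and $\sigma,\rho:\mathscr C\to\mathscr B$ such that 1. $q$ is left adjoint to $i$, which is left adjoint to $p$; and $\sigma$ is left adjoint to $j$, which is left adjoint to $\rho$; 2. $i$, $\sigma$ and $\rho$ are fully faithful; 3. the essential image of $i$ is the kernel of $j$, i.e. an object $Y$ of $\mathscr B$ is isomorphic to some $i(X)$ if and only if $j(Y)=0$. -/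

import Mathlib

open CategoryTheory CategoryTheory.Limits

universe u v w x

/-! ### Directed graphs -/

set_option linter.checkUnivs false in
/-- A directed graph `E = (E⁰, E¹, r, s)`: a set of vertices, a set of edges (both arbitrary), and
the range and source maps. Loops and parallel edges are allowed. -/
structure DirectedGraph where
  /-- the set `E⁰` of vertices -/
  Vertex : Type v
  /-- the set `E¹` of edges -/
  Edge : Type w
  /-- the range of an edge -/
  r : Edge → Vertex
  /-- the source of an edge -/
  s : Edge → Vertex

namespace DirectedGraph

variable (E : DirectedGraph.{v, w})

/-- `E` is row-finite if every vertex emits only finitely many edges. -/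
def RowFinite : Prop :=
  ∀ y : E.Vertex, {e : E.Edge | E.s e = y}.Finite

/-- `H` is hereditary if every edge with source in `H` has its range in `H`. -/
def IsHereditary (H : Set E.Vertex) : Prop :=
  ∀ e : E.Edge, E.s e ∈ H → E.r e ∈ H

/-- `H` is saturated if it contains every vertex `y` that emits at least one and only finitely many
edges, all of them with range in `H` (in a row-finite graph the finiteness is automatic). -/
def IsSaturated (H : Set E.Vertex) : Prop :=
  ∀ y : E.Vertex, {e : E.Edge | E.s e = y}.Finite → {e : E.Edge | E.s e = y}.Nonempty →
    (∀ e : E.Edge, E.s e = y → E.r e ∈ H) → y ∈ H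

/-- The hereditary saturated closure of `H`: the smallest hereditary and saturated set of vertices
that contains `H`. -/
def hereditarySaturatedClosure (H : Set E.Vertex) : Set E.Vertex :=
  ⋂₀ {X | H ⊆ X ∧ E.IsHereditary X ∧ E.IsSaturated X}

theorem subset_hereditarySaturatedClosure (H : Set E.Vertex) :
    H ⊆ E.hereditarySaturatedClosure H :=
  fun _ hy _ hX => hX.1 hy

theorem isHereditary_hereditarySaturatedClosure (H : Set E.Vertex) :
    E.IsHereditary (E.hereditarySaturatedClosure H) :=
  fun e he X hX => hX.2.1 e (he X hX)

theorem isSaturated_hereditarySaturatedClosure (H : Set E.Vertex) :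
    E.IsSaturated (E.hereditarySaturatedClosure H) :=
  fun y hfin hne hr X hX => hX.2.2 y hfin hne fun e he => hr e he X hX

/-- The restriction graph `E_H` of a hereditary set `H`: its vertices are those in `H`, its edges
are the edges of `E` with source in `H`. -/
def restriction (H : Set E.Vertex) (hH : E.IsHereditary H) : DirectedGraph.{v, w} where
  Vertex := {y : E.Vertex // y ∈ H}
  Edge := {e : E.Edge // E.s e ∈ H}
  r e := ⟨E.r e.1, hH e.1 e.2⟩
  s e := ⟨E.s e.1, e.2⟩

/-- The quotient graph `E/X` of a hereditary (and saturated) set `X`: its vertices are those not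
in `X`, its edges are the edges of `E` with range not in `X`. -/
def quotient (X : Set E.Vertex) (hX : E.IsHereditary X) : DirectedGraph.{v, w} where
  Vertex := {y : E.Vertex // y ∉ X}
  Edge := {e : E.Edge // E.r e ∉ X}
  r e := ⟨E.r e.1, e.2⟩
  s e := ⟨E.s e.1, fun h => e.2 (hX e.1 h)⟩

end DirectedGraph

/-! ### Rings with local units -/

/-- A (not necessarily unital) ring has local units if every finite subset lies in `eRe` for some
idempotent `e`. -/
class HasLocalUnits (R : Type u) [NonUnitalRing R] : Prop where
  exists_unit : ∀ F : Finset R, ∃ e : R, e * e = e ∧ ∀ a ∈ F, e * a = a ∧ a * e = a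

/-! ### Leavitt path algebras -/

namespace LeavittPathAlgebra

/-- The generators of the Leavitt path algebra: the vertices `v`, the edges `e` and the ghost
edges `e*`. -/
inductive Generator (E : DirectedGraph.{v, w}) : Type (max v w)
  | vertex (y : E.Vertex) : Generator E
  | edge (e : E.Edge) : Generator E
  | ghost (e : E.Edge) : Generator E

variable (K : Type u) [Field K] (E : DirectedGraph.{v, w})

/-- The free non-unital associative `K`-algebra on the generators. -/
abbrev FreeAlg : Type (max u v w) := MonoidAlgebra K (FreeSemigroup (Generator E))

/-- A generator, seen in the free algebra. -/
noncomputable def FreeAlg.of (g : Generator E) : FreeAlg K E :=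
  MonoidAlgebra.single (FreeSemigroup.of g) 1

open Generator in
/-- The defining relations of the Leavitt path algebra, and their scalar multiples. -/
inductive Rel : FreeAlg K E → FreeAlg K E → Prop
  | vertex_mul_self (y : E.Vertex) :
      Rel (FreeAlg.of K E (vertex y) * FreeAlg.of K E (vertex y)) (FreeAlg.of K E (vertex y))
  | vertex_mul_vertex (y z : E.Vertex) (h : y ≠ z) :
      Rel (FreeAlg.of K E (vertex y) * FreeAlg.of K E (vertex z)) 0
  | source_mul_edge (e : E.Edge) :
      Rel (FreeAlg.of K E (vertex (E.s e)) * FreeAlg.of K E (edge e)) (FreeAlg.of K E (edge e))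
  | edge_mul_range (e : E.Edge) :
      Rel (FreeAlg.of K E (edge e) * FreeAlg.of K E (vertex (E.r e))) (FreeAlg.of K E (edge e))
  | range_mul_ghost (e : E.Edge) :
      Rel (FreeAlg.of K E (vertex (E.r e)) * FreeAlg.of K E (ghost e)) (FreeAlg.of K E (ghost e))
  | ghost_mul_source (e : E.Edge) :
      Rel (FreeAlg.of K E (ghost e) * FreeAlg.of K E (vertex (E.s e))) (FreeAlg.of K E (ghost e))
  | ghost_mul_edge_self (e : E.Edge) :
      Rel (FreeAlg.of K E (ghost e) * FreeAlg.of K E (edge e)) (FreeAlg.of K E (vertex (E.r e)))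
  | ghost_mul_edge (e f : E.Edge) (h : e ≠ f) :
      Rel (FreeAlg.of K E (ghost e) * FreeAlg.of K E (edge f)) 0
  | sum_edge_mul_ghost (y : E.Vertex) (hfin : {e : E.Edge | E.s e = y}.Finite)
      (hne : {e : E.Edge | E.s e = y}.Nonempty) :
      Rel (∑ e ∈ hfin.toFinset, FreeAlg.of K E (edge e) * FreeAlg.of K E (ghost e))
        (FreeAlg.of K E (vertex y))
  | smul (c : K) {a b : FreeAlg K E} (h : Rel a b) : Rel (c • a) (c • b)

/-- The ring congruence on the free algebra generated by the relations. It is compatible with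
scalars because the set of relations is. -/
noncomputable abbrev con : RingCon (FreeAlg K E) := ringConGen (Rel K E)

theorem con_smul (c : K) {a b : FreeAlg K E} (h : con K E a b) : con K E (c • a) (c • b) := by
  change RingConGen.Rel (Rel K E) (c • a) (c • b)
  replace h : RingConGen.Rel (Rel K E) a b := h
  induction h with
  | of _ _ h' => exact .of _ _ (.smul c h')
  | refl _ => exact .refl _
  | symm _ ih => exact .symm ih
  | trans h₁ h₂ ih₁ ih₂ => exact .trans ih₁ ih₂
  | add h₁ h₂ ih₁ ih₂ => rw [smul_add, smul_add]; exact .add ih₁ ih₂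
  | mul h₁ h₂ ih₁ _ => rw [← smul_mul_assoc, ← smul_mul_assoc]; exact .mul ih₁ h₂

end LeavittPathAlgebra

/-- The Leavitt path algebra `L_K(E)`: the non-unital associative `K`-algebra generated by the
vertices, edges and ghost edges of `E` subject to the relations `LeavittPathAlgebra.Rel`. -/
def LeavittPathAlgebra (K : Type u) [Field K] (E : DirectedGraph.{v, w}) : Type (max u v w) :=
  (LeavittPathAlgebra.con K E).Quotient

namespace LeavittPathAlgebra

variable (K : Type u) [Field K] (E : DirectedGraph.{v, w})

noncomputable instance : NonUnitalRing (LeavittPathAlgebra K E) :=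
  inferInstanceAs (NonUnitalRing (con K E).Quotient)

/-- The quotient map from the free algebra, as a ring homomorphism. -/
noncomputable def mk : FreeAlg K E →ₙ+* LeavittPathAlgebra K E where
  toFun a := (a : (con K E).Quotient)
  map_mul' _ _ := rfl
  map_zero' := rfl
  map_add' _ _ := rfl

theorem mk_surjective : Function.Surjective (mk K E) :=
  Quotient.mk''_surjective

noncomputable instance : SMul K (LeavittPathAlgebra K E) where
  smul c := Quotient.map' (c • ·) fun _ _ h => con_smul K E c h

theorem mk_smul (c : K) (a : FreeAlg K E) : mk K E (c • a) = c • mk K E a := rfl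

noncomputable instance : Module K (LeavittPathAlgebra K E) :=
  Function.Surjective.module K (mk K E).toAddMonoidHom (mk_surjective K E) (mk_smul K E)

instance : IsScalarTower K (LeavittPathAlgebra K E) (LeavittPathAlgebra K E) where
  smul_assoc c a b := by
    obtain ⟨a, rfl⟩ := mk_surjective K E a
    obtain ⟨b, rfl⟩ := mk_surjective K E b
    simp only [smul_eq_mul, ← mk_smul, ← map_mul, smul_mul_assoc]

instance : SMulCommClass K (LeavittPathAlgebra K E) (LeavittPathAlgebra K E) where
  smul_comm c a b := by
    obtain ⟨a, rfl⟩ := mk_surjective K E a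
    obtain ⟨b, rfl⟩ := mk_surjective K E b
    simp only [smul_eq_mul, ← mk_smul, ← map_mul, mul_smul_comm]

/-- The image of a generator in `L_K(E)`. -/
noncomputable def gen (g : Generator E) : LeavittPathAlgebra K E := mk K E (FreeAlg.of K E g)

theorem mk_eq_of_rel {a b : FreeAlg K E} (h : Rel K E a b) : mk K E a = mk K E b :=
  (RingCon.eq _).2 (RingConGen.Rel.of _ _ h)

open Classical in
theorem gen_vertex_mul (y z : E.Vertex) :
    gen K E (.vertex y) * gen K E (.vertex z) = if y = z then gen K E (.vertex y) else 0 := by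
  split_ifs with h
  · subst h
    exact mk_eq_of_rel K E (.vertex_mul_self y)
  · exact (mk_eq_of_rel K E (.vertex_mul_vertex y z h)).trans (map_zero _)

/-- The idempotent `∑_{y ∈ F} y` of a finite set `F` of vertices. -/
noncomputable def vertexSum (F : Finset E.Vertex) : LeavittPathAlgebra K E :=
  ∑ y ∈ F, gen K E (.vertex y)

theorem vertexSum_mul_vertex {F : Finset E.Vertex} {y : E.Vertex} (hy : y ∈ F) :
    vertexSum K E F * gen K E (.vertex y) = gen K E (.vertex y) := by
  classical
  simp [vertexSum, Finset.sum_mul, gen_vertex_mul, hy]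

theorem vertex_mul_vertexSum {F : Finset E.Vertex} {y : E.Vertex} (hy : y ∈ F) :
    gen K E (.vertex y) * vertexSum K E F = gen K E (.vertex y) := by
  classical
  simp [vertexSum, Finset.mul_sum, gen_vertex_mul, hy]

theorem vertexSum_mul_self (F : Finset E.Vertex) :
    vertexSum K E F * vertexSum K E F = vertexSum K E F := by
  conv_lhs => rw [vertexSum, Finset.sum_mul]
  exact Finset.sum_congr rfl fun y hy => vertex_mul_vertexSum K E hy

theorem exists_unit_of_absorb {a : LeavittPathAlgebra K E} (y z : E.Vertex)
    (h₁ : gen K E (.vertex y) * a = a) (h₂ : a * gen K E (.vertex z) = a) :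
    ∃ F₀ : Finset E.Vertex, ∀ F, F₀ ⊆ F → vertexSum K E F * a = a ∧ a * vertexSum K E F = a := by
  classical
  refine ⟨{y, z}, fun F hF => ⟨?_, ?_⟩⟩
  · rw [← h₁, ← mul_assoc, vertexSum_mul_vertex K E (hF (by simp))]
  · rw [← h₂, mul_assoc, vertex_mul_vertexSum K E (hF (by simp))]

theorem exists_unit_mk (a : FreeAlg K E) :
    ∃ F₀ : Finset E.Vertex, ∀ F, F₀ ⊆ F →
      vertexSum K E F * mk K E a = mk K E a ∧ mk K E a * vertexSum K E F = mk K E a := by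
  classical
  induction a using MonoidAlgebra.induction_linear with
  | zero => exact ⟨∅, fun F _ => by simp⟩
  | add a b ha hb =>
    obtain ⟨F₁, h₁⟩ := ha
    obtain ⟨F₂, h₂⟩ := hb
    refine ⟨F₁ ∪ F₂, fun F hF => ?_⟩
    have h₁ := h₁ F (Finset.union_subset_left hF)
    have h₂ := h₂ F (Finset.union_subset_right hF)
    simp [mul_add, add_mul, h₁, h₂]
  | single g c =>
    have key : ∃ F₀ : Finset E.Vertex, ∀ F, F₀ ⊆ F →
        vertexSum K E F * mk K E (.single g 1) = mk K E (.single g 1) ∧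
          mk K E (.single g 1) * vertexSum K E F = mk K E (.single g 1) := by
      induction g using FreeSemigroup.recOnMul with
      | ih1 g =>
        change ∃ F₀ : Finset E.Vertex, ∀ F, F₀ ⊆ F →
          vertexSum K E F * gen K E g = gen K E g ∧ gen K E g * vertexSum K E F = gen K E g
        cases g with
        | vertex y =>
          exact exists_unit_of_absorb K E y y (by simp [gen_vertex_mul]) (by simp [gen_vertex_mul])
        | edge e =>
          exact exists_unit_of_absorb K E (E.s e) (E.r e)
            (mk_eq_of_rel K E (.source_mul_edge e)) (mk_eq_of_rel K E (.edge_mul_range e))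
        | ghost e =>
          exact exists_unit_of_absorb K E (E.r e) (E.s e)
            (mk_eq_of_rel K E (.range_mul_ghost e)) (mk_eq_of_rel K E (.ghost_mul_source e))
      | ih2 g g' hg hg' =>
        obtain ⟨F₁, h₁⟩ := hg
        obtain ⟨F₂, h₂⟩ := hg'
        refine ⟨F₁ ∪ F₂, fun F hF => ?_⟩
        have h₁ := h₁ F (Finset.union_subset_left hF)
        have h₂ := h₂ F (Finset.union_subset_right hF)
        have e : mk K E (.single (FreeSemigroup.of g * g') 1) =
            mk K E (.single (FreeSemigroup.of g) 1) * mk K E (.single g' 1) := by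
          rw [← map_mul, MonoidAlgebra.single_mul_single, one_mul]
        rw [e]
        exact ⟨by rw [← mul_assoc, h₁.1], by rw [mul_assoc, h₂.2]⟩
    obtain ⟨F₀, h⟩ := key
    refine ⟨F₀, fun F hF => ?_⟩
    have e : mk K E (.single g c) = c • mk K E (.single g 1) := by
      rw [← mk_smul, MonoidAlgebra.smul_single, smul_eq_mul, mul_one]
    rw [e, mul_smul_comm, smul_mul_assoc, (h F hF).1, (h F hF).2]
    exact ⟨rfl, rfl⟩

instance : HasLocalUnits (LeavittPathAlgebra K E) where
  exists_unit S := by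
    classical
    suffices h : ∃ F₀ : Finset E.Vertex, ∀ F, F₀ ⊆ F → ∀ a ∈ S,
        vertexSum K E F * a = a ∧ a * vertexSum K E F = a by
      obtain ⟨F₀, h⟩ := h
      exact ⟨vertexSum K E F₀, vertexSum_mul_self K E F₀, h F₀ subset_rfl⟩
    induction S using Finset.induction_on with
    | empty => exact ⟨∅, by simp⟩
    | insert a S _ ih =>
      obtain ⟨F₁, h₁⟩ := ih
      obtain ⟨a, rfl⟩ := mk_surjective K E a
      obtain ⟨F₂, h₂⟩ := exists_unit_mk K E a
      refine ⟨F₁ ∪ F₂, fun F hF b hb => ?_⟩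
      rcases Finset.mem_insert.1 hb with rfl | hb
      · exact h₂ F (Finset.union_subset_right hF)
      · exact h₁ F (Finset.union_subset_left hF) b hb

end LeavittPathAlgebra

/-! ### Modules over rings with local units -/

/-- The ring `ℤ ⊕ R` obtained from a (not necessarily unital) ring `R` by adjoining an identity. -/
def AdjoinOne (R : Type u) [NonUnitalRing R] : Type u := Unitization ℤ R

namespace AdjoinOne

variable (R : Type u) [NonUnitalRing R]

instance : Ring (AdjoinOne R) := inferInstanceAs (Ring (Unitization ℤ R))

/-- The inclusion of `R` in `ℤ ⊕ R`. -/
def of : R →ₙ+* AdjoinOne R where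
  toFun a := (Unitization.inr a : Unitization ℤ R)
  map_mul' := Unitization.inr_mul ℤ
  map_zero' := Unitization.inr_zero ℤ
  map_add' := Unitization.inr_add ℤ

end AdjoinOne

/-- Left modules over a non-unital ring `R` (abelian groups `M` with a biadditive action of `R` such
that `(ab)m = a(bm)`) are the same as modules over the unital ring `ℤ ⊕ R`. Such a module `M` is
called unital if `RM = M`, i.e. if every element of `M` is a finite sum of elements `a m` with
`a ∈ R` and `m ∈ M`. -/
def IsUnitalModule (R : Type u) [NonUnitalRing R] : ObjectProperty (ModuleCat.{x} (AdjoinOne R)) :=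
  fun M => AddSubgroup.closure {m : M | ∃ (a : R) (n : M), m = AdjoinOne.of R a • n} = ⊤

/-- The category `R-Mod` of unital left `R`-modules, for a ring `R` with local units: its objects
are the left `R`-modules `M` with `RM = M`, its morphisms are all `R`-linear maps. If `R` has an
identity element, these are the usual left `R`-modules. -/
abbrev UnitalModuleCat (R : Type u) [NonUnitalRing R] : Type (max u (x + 1)) :=
  (IsUnitalModule.{u, x} R).FullSubcategory

namespace UnitalModuleCat

variable (R : Type u) [NonUnitalRing R]

theorem isUnitalModule_of_forall {M : ModuleCat.{x} (AdjoinOne R)}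
    (h : ∀ m : M, ∃ a : R, AdjoinOne.of R a • m = m) : IsUnitalModule R M := by
  refine eq_top_iff.2 fun m _ => AddSubgroup.subset_closure ?_
  obtain ⟨a, ha⟩ := h m
  exact ⟨a, m, ha.symm⟩

theorem exists_finset_smul_eq {M : ModuleCat.{x} (AdjoinOne R)} (hM : IsUnitalModule R M) (m : M) :
    ∃ F : Finset R, ∀ e : R, (∀ a ∈ F, e * a = a) → AdjoinOne.of R e • m = m := by
  classical
  have hm : m ∈ AddSubgroup.closure {m : M | ∃ (a : R) (n : M), m = AdjoinOne.of R a • n} := by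
    rw [show AddSubgroup.closure _ = _ from hM]; trivial
  induction hm using AddSubgroup.closure_induction with
  | mem m hm =>
    obtain ⟨a, n, rfl⟩ := hm
    refine ⟨{a}, fun e he => ?_⟩
    rw [← mul_smul, ← map_mul, he a (by simp)]
  | zero => exact ⟨∅, fun e _ => smul_zero _⟩
  | add m n _ _ hm hn =>
    obtain ⟨F₁, h₁⟩ := hm
    obtain ⟨F₂, h₂⟩ := hn
    refine ⟨F₁ ∪ F₂, fun e he => ?_⟩
    rw [smul_add, h₁ e fun a ha => he a (Finset.mem_union_left _ ha),
      h₂ e fun a ha => he a (Finset.mem_union_right _ ha)]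
  | neg m _ hm =>
    obtain ⟨F, h⟩ := hm
    exact ⟨F, fun e he => by rw [smul_neg, h e he]⟩

variable [HasLocalUnits R]

/-! Over a ring with local units, unital modules are closed under submodules, quotients and finite
products; hence `UnitalModuleCat R` is an abelian category, by a general instance for full
subcategories. -/

instance : (IsUnitalModule.{u, x} R).IsClosedUnderSubobjects where
  prop_of_mono {X Y} f _ hY := by
    refine isUnitalModule_of_forall R fun m => ?_
    obtain ⟨F, h⟩ := exists_finset_smul_eq R hY (f m)
    obtain ⟨e, -, he⟩ := HasLocalUnits.exists_unit F
    refine ⟨e, (ModuleCat.mono_iff_injective f).1 inferInstance ?_⟩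
    rw [map_smul, h e fun a ha => (he a ha).1]

instance : (IsUnitalModule.{u, x} R).IsClosedUnderQuotients where
  prop_of_epi {X Y} f _ hX := by
    refine isUnitalModule_of_forall R fun m => ?_
    obtain ⟨m, rfl⟩ := (ModuleCat.epi_iff_surjective f).1 inferInstance m
    obtain ⟨F, h⟩ := exists_finset_smul_eq R hX m
    obtain ⟨e, -, he⟩ := HasLocalUnits.exists_unit F
    exact ⟨e, by rw [← map_smul, h e fun a ha => (he a ha).1]⟩

instance : (IsUnitalModule.{u, x} R).ContainsZero where
  exists_zero := ⟨ModuleCat.of _ PUnit, ModuleCat.isZero_of_subsingleton _,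
    isUnitalModule_of_forall R fun _ => ⟨0, Subsingleton.elim _ _⟩⟩

instance : (IsUnitalModule.{u, x} R).IsClosedUnderFiniteProducts where
  isClosedUnderLimitsOfShape J _ := ⟨by
    classical
    rintro X ⟨p⟩
    refine isUnitalModule_of_forall R fun m => ?_
    choose F h using fun j : Discrete J =>
      exists_finset_smul_eq R (p.prop_diag_obj j) (p.π.app j m)
    have := Fintype.ofFinite J
    obtain ⟨e, -, he⟩ := HasLocalUnits.exists_unit (Finset.univ.biUnion fun j : J => F ⟨j⟩)
    refine ⟨e, Concrete.isLimit_ext _ p.isLimit _ _ fun j => ?_⟩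
    change p.π.app j (AdjoinOne.of R e • m) = p.π.app j m
    rw [map_smul]
    exact h j e fun a ha => (he a (Finset.mem_biUnion.2 ⟨j.as, Finset.mem_univ _, ha⟩)).1⟩

end UnitalModuleCat

/-! ### Recollements -/

/-- A recollement of abelian categories: functors `q, p : B ⥤ A`, `i : A ⥤ B`, `j : B ⥤ C` and
`s, r : C ⥤ B` such that `(s, j, r)` and `(q, i, p)` are adjoint triples, the functors `i`, `s`
and `r` are fully faithful, and the (essential) image of `i` is the kernel of `j`. -/
structure Recollement (A : Type*) [Category* A] [Abelian A] (B : Type*) [Category* B] [Abelian B]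
    (C : Type*) [Category* C] [Abelian C] where
  i : A ⥤ B
  q : B ⥤ A
  p : B ⥤ A
  j : B ⥤ C
  s : C ⥤ B
  r : C ⥤ B
  /-- `q` is left adjoint to `i` -/
  adj_qi : q ⊣ i
  /-- `i` is left adjoint to `p` -/
  adj_ip : i ⊣ p
  /-- `s` is left adjoint to `j` -/
  adj_sj : s ⊣ j
  /-- `j` is left adjoint to `r` -/
  adj_jr : j ⊣ r
  i_full : i.Full
  i_faithful : i.Faithful
  s_full : s.Full
  s_faithful : s.Faithful
  r_full : r.Full
  r_faithful : r.Faithful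
  /-- the image of `i` (closed under isomorphism) is the kernel of `j` -/
  essImage_i_iff : ∀ Y : B, i.essImage Y ↔ IsZero (j.obj Y)

/-! Write R = L_K(E), T = L_K(E_H), Q = L_K(E/H̄). As H is finite, ε = ∑_{y ∈ H} y is an idempotent
of R, and the recollement is the one attached to an idempotent: T is the corner εRε, Q is R/RεR, j
is M ↦ εM, and i is restriction along R → Q.

Module side (`nonempty_recollement`). Rings with local units are handled through ℤ ⊕ R: extension,
restriction and coextension of scalars along the induced unital ring maps, cut down to the unital
part RM where necessary, give all six functors. Since T has an identity, its unital part is a left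
as well as a right adjoint of the inclusion, so j has adjoints on both sides. The counit of j ⊣ ρ is
evaluation at 1, and it is bijective because a T-linear function fixed by ε is determined by its
value at 1, which may be arbitrary; hence ρ is fully faithful, and then so is σ by the general
theory of adjoint triples. Finally εY = 0 says that the annihilator of Y, a two-sided ideal,
contains ε; it then contains the kernel of R → Q, so Y is a Q-module.

Graph side. Three facts are needed. (1) T → R is injective (`ofRestriction_injective`): R acts on
functions of paths that enter H with their last edge, and T acts by left multiplication on the value
at the empty path. (2) Its image is εRε (`exists_ofRestriction_eq`): εR is spanned by words a e₁* ⋯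
eₙ* with a from T, and right multiplication by ε sends each of them into the image of T. (3) The
kernel of R → Q lies in every ideal J that contains ε (`mem_of_toQuotient_eq_zero`): J contains all
vertices of H̄, and modulo J the remaining generators satisfy the relations of Q. -/

/-! ### Extension of scalars over noncommutative rings -/

namespace ModuleCat

open TensorProduct

variable {A B : Type u} [Ring A] [Ring B] (f : A →+* B)

/-- The relations `bf(a) ⊗ n = b ⊗ an` defining `B ⊗[A] N` as a quotient of `B ⊗[ℤ] N`. -/
def balancedRelations (N : ModuleCat.{u} A) : Submodule B (B ⊗[ℤ] N) :=
  Submodule.span B {x | ∃ (b : B) (a : A) (n : N), x = (b * f a) ⊗ₜ n - b ⊗ₜ (a • n)}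

/-- The `B`-module `B ⊗[A] N`, for a homomorphism `A → B` of noncommutative rings. -/
abbrev balancedTensor (N : ModuleCat.{u} A) : ModuleCat.{u} B :=
  ModuleCat.of B ((B ⊗[ℤ] N) ⧸ balancedRelations f N)

/-- The pure tensors of `balancedTensor`. -/
def balancedTensor.tmul {N : ModuleCat.{u} A} (b : B) (n : N) : balancedTensor f N :=
  (balancedRelations f N).mkQ (b ⊗ₜ n)

theorem balancedTensor.tmul_smul {N : ModuleCat.{u} A} (b : B) (a : A) (n : N) :
    tmul f b (a • n) = tmul f (b * f a) n :=
  ((Submodule.Quotient.eq (balancedRelations f N)).2 (Submodule.subset_span ⟨b, a, n, rfl⟩)).symm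

theorem balancedTensor.smul_tmul {N : ModuleCat.{u} A} (b b' : B) (n : N) :
    b • tmul f b' n = tmul f (b * b') n := rfl

theorem balancedTensor.tmul_add {N : ModuleCat.{u} A} (b : B) (n n' : N) :
    tmul f b (n + n') = tmul f b n + tmul f b n' := by
  simp only [tmul, TensorProduct.tmul_add, map_add]

theorem balancedTensor.induction {N : ModuleCat.{u} A} {p : balancedTensor f N → Prop}
    (zero : p 0) (tmul : ∀ b n, p (tmul f b n)) (add : ∀ x y, p x → p y → p (x + y))
    (x : balancedTensor f N) : p x := by
  obtain ⟨x, rfl⟩ := Submodule.mkQ_surjective _ x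
  induction x using TensorProduct.induction_on with
  | zero => simpa using zero
  | tmul b n => exact tmul b n
  | add x y hx hy => rw [map_add]; exact add _ _ hx hy

/-- The elements 1 ⊗ n generate B ⊗[A] N over B. -/
theorem balancedTensor.hom_ext {N : ModuleCat.{u} A} {Y : ModuleCat.{u} B}
    {g h : balancedTensor f N ⟶ Y} (H : ∀ n : N, g (tmul f 1 n) = h (tmul f 1 n)) : g = h := by
  refine ModuleCat.hom_ext (LinearMap.ext fun x => ?_)
  change g x = h x
  refine balancedTensor.induction f (p := fun x => g x = h x) ?_ ?_ ?_ x
  · simp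
  · intro b n
    have e : tmul f b n = b • tmul f 1 n := by rw [smul_tmul, mul_one]
    rw [e, map_smul, map_smul, H]
  · intro x y hx hy
    rw [map_add, map_add, hx, hy]

/-- The `B`-linear map out of `B ⊗[A] N` given by a semilinear map out of `N`. -/
noncomputable def balancedTensor.desc {N : ModuleCat.{u} A} {Y : ModuleCat.{u} B}
    (h : N →ₛₗ[f] Y) : balancedTensor f N ⟶ Y :=
  ModuleCat.ofHom <| (balancedRelations f N).liftQ
    (TensorProduct.AlgebraTensorModule.lift
      (LinearMap.toSpanSingleton B (N →ₗ[ℤ] Y) (h.toAddMonoidHom.toIntLinearMap))) (by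
      rw [balancedRelations, Submodule.span_le]
      rintro _ ⟨b, a, n, rfl⟩
      simp [mul_smul])

theorem balancedTensor.desc_tmul {N : ModuleCat.{u} A} {Y : ModuleCat.{u} B}
    (h : N →ₛₗ[f] Y) (b : B) (n : N) : desc f h (tmul f b n) = b • h n := rfl

/-- The universal property of `B ⊗[A] N`. -/
noncomputable def balancedTensor.homEquiv (N : ModuleCat.{u} A) (Y : ModuleCat.{u} B) :
    (balancedTensor f N ⟶ Y) ≃ (N ⟶ (restrictScalars f).obj Y) :=
  Equiv.trans
    { toFun := fun g =>
        { toFun := fun n => g (tmul f 1 n)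
          map_add' := fun n n' => by rw [tmul_add, map_add]
          map_smul' := fun a n => by rw [tmul_smul, ← map_smul, smul_tmul, one_mul, mul_one] }
      invFun := fun h => desc f h
      left_inv := fun g => hom_ext f fun n => (desc_tmul f _ 1 n).trans (one_smul B _)
      right_inv := fun h => LinearMap.ext fun n => (desc_tmul f h 1 n).trans (one_smul B _) }
    (semilinearMapAddEquiv f N Y).toEquiv

/-- Extension of scalars along a homomorphism of noncommutative rings. -/
noncomputable def extendScalarsNoncomm : ModuleCat.{u} A ⥤ ModuleCat.{u} B :=
  Adjunction.leftAdjointOfEquiv (G := restrictScalars f) (balancedTensor.homEquiv f)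
    fun _ _ _ _ _ => rfl

/-- Extension of scalars is left adjoint to restriction of scalars. -/
noncomputable def extendRestrictScalarsNoncommAdj : extendScalarsNoncomm f ⊣ restrictScalars.{u} f :=
  Adjunction.adjunctionOfEquivLeft _ _

end ModuleCat

/-! ### The functors between categories of unital modules -/

namespace AdjoinOne

variable {R R' : Type u} [NonUnitalRing R] [NonUnitalRing R']

theorem exists_eq (s : AdjoinOne R) : ∃ (z : ℤ) (a : R), s = z • (1 : AdjoinOne R) + of R a := by
  let s' : Unitization ℤ R := s
  refine ⟨s'.fst, s'.snd, (Unitization.inl_fst_add_inr_snd_eq s').symm.trans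
    (congrArg (· + (Unitization.inr s'.snd : Unitization ℤ R)) ?_)⟩
  exact Algebra.algebraMap_eq_smul_one (A := Unitization ℤ R) s'.fst

theorem of_injective : Function.Injective (of R) := Unitization.inr_injective

/-- R is an ideal of ℤ ⊕ R. On a unital module, where m = am for some a in R, this replaces an
arbitrary scalar acting on m by an element of R. -/
theorem exists_mul_of (s : AdjoinOne R) (a : R) : ∃ b, s * of R a = of R b := by
  obtain ⟨z, c, rfl⟩ := exists_eq s
  exact ⟨z • a + c * a, by simp [add_mul]⟩

/-- The ring homomorphism `ℤ ⊕ R → ℤ ⊕ R'` given by a homomorphism `R → R'`. -/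
def map (f : R →ₙ+* R') : AdjoinOne R →+* AdjoinOne R' :=
  AlgHom.toRingHom (A := Unitization ℤ R) (Unitization.lift (R := ℤ) (A := R) (C := AdjoinOne R')
    { ((of R').comp f) with
      map_smul' := fun z a => map_zsmul ((of R').comp f) z a })

theorem map_of (f : R →ₙ+* R') (a : R) : map f (of R a) = of R' (f a) := by
  change Unitization.lift (R := ℤ) (A := R) (C := AdjoinOne R') _ (Unitization.inr a) = _
  simp

theorem map_surjective {f : R →ₙ+* R'} (hf : Function.Surjective f) :
    Function.Surjective (map f) := by
  intro s
  obtain ⟨z, a, rfl⟩ := exists_eq s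
  obtain ⟨a, rfl⟩ := hf a
  exact ⟨z • 1 + of R a, by simp [map_of]⟩

end AdjoinOne

namespace UnitalModuleCat

open ModuleCat

variable {R R' : Type u} [NonUnitalRing R] [NonUnitalRing R']

/-- A local unit for the finitely many coefficients in an expression of m as a sum of products fixes
m. This elementwise form of RM = M is the one used throughout. -/
theorem exists_smul_eq [HasLocalUnits R] {M : ModuleCat.{x} (AdjoinOne R)}
    (hM : IsUnitalModule R M) (m : M) : ∃ a : R, AdjoinOne.of R a • m = m := by
  obtain ⟨F, hF⟩ := exists_finset_smul_eq R hM m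
  obtain ⟨e, -, he⟩ := HasLocalUnits.exists_unit F
  exact ⟨e, hF e fun a ha => (he a ha).1⟩

theorem smul_eq_of_left_identity [HasLocalUnits R] {M : ModuleCat.{x} (AdjoinOne R)}
    (hM : IsUnitalModule R M) {u : R} (hu : ∀ a, u * a = a) (m : M) : AdjoinOne.of R u • m = m := by
  obtain ⟨a, ha⟩ := exists_smul_eq hM m
  rw [← ha, ← mul_smul, ← map_mul, hu]

/-! ### The unital part of a module and its adjunctions with the inclusion -/

section UnitalPart

variable [HasLocalUnits R]

/-- The unital part `RM` of a module `M`. -/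
def unitalSubmodule (M : ModuleCat.{x} (AdjoinOne R)) : Submodule (AdjoinOne R) M where
  carrier := {m | ∃ a : R, AdjoinOne.of R a • m = m}
  zero_mem' := ⟨0, smul_zero _⟩
  add_mem' := by
    classical
    rintro m n ⟨a, ha⟩ ⟨b, hb⟩
    obtain ⟨e, -, he⟩ := HasLocalUnits.exists_unit ({a, b} : Finset R)
    refine ⟨e, ?_⟩
    rw [smul_add, ← ha, ← hb, ← mul_smul, ← mul_smul, ← map_mul, ← map_mul,
      (he a (by simp)).1, (he b (by simp)).1]
  smul_mem' := by
    rintro s m ⟨a, ha⟩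
    obtain ⟨b, hb⟩ := AdjoinOne.exists_mul_of s a
    obtain ⟨e, -, he⟩ := HasLocalUnits.exists_unit ({b} : Finset R)
    refine ⟨e, ?_⟩
    rw [← ha, ← mul_smul s, hb, ← mul_smul, ← map_mul, (he b (by simp)).1]

theorem mem_unitalSubmodule {M : ModuleCat.{x} (AdjoinOne R)} {m : M} :
    m ∈ unitalSubmodule M ↔ ∃ a : R, AdjoinOne.of R a • m = m := Iff.rfl

/-- The unital part of a module, as an object of the category of unital modules. -/
def unitalPartObj (M : ModuleCat.{x} (AdjoinOne R)) : UnitalModuleCat.{u, x} R where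
  obj := ModuleCat.of _ (unitalSubmodule M)
  property := isUnitalModule_of_forall R fun m => by
    obtain ⟨m, a, ha⟩ := m
    exact ⟨a, Subtype.ext ha⟩

/-- Maps from a unital module land in the unital part. -/
def unitalPartHomEquiv (X : UnitalModuleCat.{u, x} R) (M : ModuleCat.{x} (AdjoinOne R)) :
    ((IsUnitalModule R).ι.obj X ⟶ M) ≃ (X ⟶ unitalPartObj M) where
  toFun g := ObjectProperty.homMk (ModuleCat.ofHom (g.hom.codRestrict (unitalSubmodule M) fun m => by
    obtain ⟨a, ha⟩ := exists_smul_eq X.property m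
    exact ⟨a, by rw [← map_smul]; exact congrArg _ ha⟩))
  invFun g := g.hom ≫ ModuleCat.ofHom (unitalSubmodule M).subtype
  left_inv _ := rfl
  right_inv _ := rfl

variable (R) in
/-- The functor sending a module to its unital part. -/
def unitalPart : ModuleCat.{x} (AdjoinOne R) ⥤ UnitalModuleCat.{u, x} R :=
  Adjunction.rightAdjointOfEquiv (F := (IsUnitalModule R).ι) unitalPartHomEquiv
    fun _ _ _ _ _ => rfl

variable (R) in
/-- The unital part is right adjoint to the inclusion. -/
def ιUnitalPartAdj : (IsUnitalModule.{u, x} R).ι ⊣ unitalPart R :=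
  Adjunction.adjunctionOfEquivRight _ _

/-- If `R` has an identity element `u`, multiplication by `u` projects onto the unital part. -/
def unitalProjection {u : R} (hu : ∀ a, u * a = a) (hu' : ∀ a, a * u = a)
    (M : ModuleCat.{x} (AdjoinOne R)) : M →ₗ[AdjoinOne R] unitalSubmodule M where
  toFun m := ⟨AdjoinOne.of R u • m, mem_unitalSubmodule.2 ⟨u, by rw [← mul_smul, ← map_mul, hu]⟩⟩
  map_add' m n := Subtype.ext (smul_add _ _ _)
  map_smul' s m := by
    refine Subtype.ext ?_
    change AdjoinOne.of R u • s • m = s • AdjoinOne.of R u • m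
    -- A two-sided identity of R is central in ℤ ⊕ R.
    obtain ⟨z, a, rfl⟩ := AdjoinOne.exists_eq s
    rw [← mul_smul, ← mul_smul, mul_add, add_mul, ← map_mul, ← map_mul, hu, hu', mul_smul_comm,
      smul_mul_assoc, mul_one, one_mul]

/-- If `R` has an identity element, maps to a unital module are determined on the unital part. -/
def unitalPartHomEquivOfIdentity {u : R} (hu : ∀ a, u * a = a) (hu' : ∀ a, a * u = a)
    (M : ModuleCat.{x} (AdjoinOne R)) (X : UnitalModuleCat.{u, x} R) :
    ((unitalPart R).obj M ⟶ X) ≃ (M ⟶ (IsUnitalModule R).ι.obj X) where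
  toFun g := ModuleCat.ofHom (unitalProjection hu hu' M) ≫ g.hom
  invFun h := ObjectProperty.homMk (ModuleCat.ofHom (unitalSubmodule M).subtype ≫ h)
  left_inv g := by
    refine ObjectProperty.hom_ext _ (ModuleCat.hom_ext (LinearMap.ext fun m => ?_))
    refine congrArg g.hom.hom (Subtype.ext ?_)
    exact congrArg Subtype.val (smul_eq_of_left_identity ((unitalPart R).obj M).property hu m)
  right_inv h := by
    refine ModuleCat.hom_ext (LinearMap.ext fun m => ?_)
    change h.hom (AdjoinOne.of R u • m) = h.hom m
    rw [map_smul]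
    exact smul_eq_of_left_identity X.property hu _

/-- If `R` has an identity element, the unital part is left adjoint to the inclusion. -/
def unitalPartιAdj {u : R} (hu : ∀ a, u * a = a) (hu' : ∀ a, a * u = a) :
    unitalPart.{u, x} R ⊣ (IsUnitalModule.{u, x} R).ι :=
  Adjunction.mkOfHomEquiv
    { homEquiv := unitalPartHomEquivOfIdentity hu hu'
      homEquiv_naturality_left_symm := fun _ _ => rfl
      homEquiv_naturality_right := fun _ _ => rfl }

end UnitalPart

/-! ### Change of rings for unital modules -/

section ChangeOfRings

variable (f : R →ₙ+* R')

/-- Surjectivity lifts the element of R' that fixes m. For the inclusion of a corner this can fail,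
which is why `unitalRestrictScalars` passes to the unital part. -/
theorem isUnitalModule_restrictScalars (hf : Function.Surjective f) [HasLocalUnits R']
    {M : ModuleCat.{x} (AdjoinOne R')} (hM : IsUnitalModule R' M) :
    IsUnitalModule R ((restrictScalars (AdjoinOne.map f)).obj M) := by
  refine isUnitalModule_of_forall R fun m => ?_
  obtain ⟨a, ha⟩ := exists_smul_eq hM m
  obtain ⟨a, rfl⟩ := hf a
  refine ⟨a, Eq.trans ?_ ha⟩
  rw [← AdjoinOne.map_of]
  rfl

/-- If am = m then s ⊗ m = s f(a) ⊗ m, and s f(a) lies in the ideal R' of ℤ ⊕ R'. -/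
theorem isUnitalModule_extendScalarsNoncomm [HasLocalUnits R] {M : ModuleCat.{u} (AdjoinOne R)}
    (hM : IsUnitalModule R M) :
    IsUnitalModule R' ((extendScalarsNoncomm (AdjoinOne.map f)).obj M) := by
  refine eq_top_iff.2 fun m _ => ?_
  refine balancedTensor.induction (AdjoinOne.map f) (N := M) (p := fun m => m ∈ _)
    (AddSubgroup.zero_mem _) (fun s m => ?_) (fun _ _ => AddSubgroup.add_mem _) m
  obtain ⟨a, ha⟩ := exists_smul_eq hM m
  obtain ⟨b, hb⟩ := AdjoinOne.exists_mul_of s (f a)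
  refine AddSubgroup.subset_closure ⟨b, balancedTensor.tmul _ 1 m, ?_⟩
  refine Eq.trans ?_ (balancedTensor.smul_tmul _ _ _ _).symm
  rw [mul_one, ← hb, ← AdjoinOne.map_of, ← balancedTensor.tmul_smul, ha]

/-- Extension of scalars for unital modules. -/
noncomputable def extendScalars [HasLocalUnits R] :
    UnitalModuleCat.{u, u} R ⥤ UnitalModuleCat.{u, u} R' :=
  (IsUnitalModule R').lift ((IsUnitalModule R).ι ⋙ extendScalarsNoncomm (AdjoinOne.map f))
    fun X => isUnitalModule_extendScalarsNoncomm f X.property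

/-- Restriction of scalars for unital modules, along a surjective homomorphism. -/
noncomputable def restrictScalars [HasLocalUnits R'] (hf : Function.Surjective f) :
    UnitalModuleCat.{u, u} R' ⥤ UnitalModuleCat.{u, u} R :=
  (IsUnitalModule R).lift ((IsUnitalModule R').ι ⋙ ModuleCat.restrictScalars (AdjoinOne.map f))
    fun X => isUnitalModule_restrictScalars f hf X.property

/-- The unital part of the coextension of scalars. -/
noncomputable def coextendScalars [HasLocalUnits R'] :
    UnitalModuleCat.{u, u} R ⥤ UnitalModuleCat.{u, u} R' :=
  (IsUnitalModule R).ι ⋙ ModuleCat.coextendScalars (AdjoinOne.map f) ⋙ unitalPart R'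

/-- The unital part of the restriction of scalars. -/
noncomputable def unitalRestrictScalars [HasLocalUnits R] :
    UnitalModuleCat.{u, u} R' ⥤ UnitalModuleCat.{u, u} R :=
  (IsUnitalModule R').ι ⋙ ModuleCat.restrictScalars (AdjoinOne.map f) ⋙ unitalPart R

/-- Both functors preserve unital modules, so the adjunction over ℤ ⊕ R and ℤ ⊕ R' restricts to
them. -/
noncomputable def extendRestrictScalarsAdj [HasLocalUnits R] [HasLocalUnits R']
    (hf : Function.Surjective f) : extendScalars f ⊣ restrictScalars f hf :=
  (extendRestrictScalarsNoncommAdj (AdjoinOne.map f)).restrictFullyFaithful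
    (IsUnitalModule R).fullyFaithfulι (IsUnitalModule R').fullyFaithfulι (Iso.refl _) (Iso.refl _)

noncomputable def restrictCoextendScalarsAdj [HasLocalUnits R] [HasLocalUnits R']
    (hf : Function.Surjective f) : restrictScalars f hf ⊣ coextendScalars f :=
  ((ιUnitalPartAdj R').comp
    (ModuleCat.restrictCoextendScalarsAdj.{u, u, u} (AdjoinOne.map f))).restrictFullyFaithful
      (Functor.FullyFaithful.id _) (IsUnitalModule R).fullyFaithfulι (Iso.refl _) (Iso.refl _)

noncomputable def extendUnitalRestrictScalarsAdj [HasLocalUnits R] :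
    extendScalars f ⊣ unitalRestrictScalars f :=
  ((ιUnitalPartAdj R).comp
    (extendRestrictScalarsNoncommAdj (AdjoinOne.map f))).restrictFullyFaithful
      (Functor.FullyFaithful.id _) (IsUnitalModule R').fullyFaithfulι (Iso.refl _) (Iso.refl _)

/-- The one adjunction that needs an identity in R: only then is the unital part, the last factor of
`unitalRestrictScalars`, known to be a left adjoint of the inclusion. -/
noncomputable def unitalRestrictCoextendScalarsAdj [HasLocalUnits R] [HasLocalUnits R'] {u : R}
    (hu : ∀ a, u * a = a) (hu' : ∀ a, a * u = a) :
    unitalRestrictScalars f ⊣ coextendScalars f :=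
  (ιUnitalPartAdj R').comp ((ModuleCat.restrictCoextendScalarsAdj.{u, u, u} (AdjoinOne.map f)).comp
    (unitalPartιAdj hu hu'))

end ChangeOfRings

end UnitalModuleCat
-- Full faithfulness, the kernel of j, and the recollement of an idempotent
namespace UnitalModuleCat

variable {R R' : Type u} [NonUnitalRing R] [NonUnitalRing R'] (f : R →ₙ+* R')

instance restrictScalars_faithful [HasLocalUnits R'] (hf : Function.Surjective f) :
    (restrictScalars f hf).Faithful where
  map_injective {X Y} g h H := by
    refine ObjectProperty.hom_ext _ (ModuleCat.hom_ext (LinearMap.ext fun m => ?_))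
    exact congrArg (fun k => k.hom.hom m) H

instance restrictScalars_full [HasLocalUnits R'] (hf : Function.Surjective f) :
    (restrictScalars f hf).Full where
  map_surjective {X Y} g := by
    refine ⟨ObjectProperty.homMk (ModuleCat.ofHom (X := X.obj) (Y := Y.obj)
      { toFun := fun m => g.hom.hom m
        map_add' := fun m n => map_add g.hom.hom m n
        map_smul' := fun s m => ?_ }), rfl⟩
    obtain ⟨s, rfl⟩ := AdjoinOne.map_surjective hf s
    exact LinearMap.map_smul g.hom.hom s m

/-- A module over `ℤ ⊕ R` annihilated by the kernel of a surjection `R → R'` is a module over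
`ℤ ⊕ R'`. -/
theorem essImage_restrictScalars [HasLocalUnits R] [HasLocalUnits R'] (hf : Function.Surjective f)
    (Y : UnitalModuleCat.{u, u} R)
    (hY : ∀ a, f a = 0 → ∀ m : Y.obj, AdjoinOne.of R a • m = 0) :
    (restrictScalars f hf).essImage Y := by
  -- The hypothesis concerns elements of R only. For m = am and sa = b in R, the equality sm = bm
  -- reduces to it, since f(b) = 0.
  have hker : ∀ s, AdjoinOne.map f s = 0 → ∀ m : Y.obj, s • m = 0 := by
    intro s hs m
    obtain ⟨a, ha⟩ := exists_smul_eq Y.property m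
    obtain ⟨b, hb⟩ := AdjoinOne.exists_mul_of s a
    rw [← ha, ← mul_smul, hb]
    refine hY b (AdjoinOne.of_injective ?_) m
    rw [← AdjoinOne.map_of, ← hb, map_mul, hs, zero_mul, map_zero]
  let act : AdjoinOne R' →+* AddMonoid.End Y.obj :=
    (AdjoinOne.map f).liftOfSurjective (AdjoinOne.map_surjective hf)
      ⟨Module.toAddMonoidEnd (AdjoinOne R) Y.obj, fun s hs =>
        AddMonoidHom.ext fun m => hker s hs m⟩
  have hact : ∀ s (m : Y.obj), act (AdjoinOne.map f s) m = s • m := fun s m =>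
    DFunLike.congr_fun (RingHom.liftOfSurjective_comp_apply (AdjoinOne.map f)
      (AdjoinOne.map_surjective hf) _ s) m
  let mod : Module (AdjoinOne R') Y.obj := Module.compHom Y.obj act
  let X : ModuleCat.{u} (AdjoinOne R') := ModuleCat.of (AdjoinOne R') Y.obj
  have hX : IsUnitalModule R' X := by
    refine isUnitalModule_of_forall R' fun (m : Y.obj) => ?_
    obtain ⟨a, ha⟩ := exists_smul_eq Y.property m
    refine ⟨f a, ?_⟩
    rw [← AdjoinOne.map_of]
    exact (hact _ _).trans ha
  let e : (ModuleCat.restrictScalars (AdjoinOne.map f)).obj X ≃ₗ[AdjoinOne R] Y.obj :=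
    { AddEquiv.refl Y.obj with map_smul' := fun s m => hact s m }
  exact ⟨⟨X, hX⟩, ⟨ObjectProperty.isoMk _ e.toModuleIso⟩⟩

theorem smul_eq_zero_of_essImage_restrictScalars [HasLocalUnits R] [HasLocalUnits R']
    (hf : Function.Surjective f)
    {Y : UnitalModuleCat.{u, u} R} (hY : (restrictScalars f hf).essImage Y) {a : R} (ha : f a = 0)
    (m : Y.obj) : AdjoinOne.of R a • m = 0 := by
  obtain ⟨X, ⟨e⟩⟩ := hY
  have h : AdjoinOne.of R a • e.inv.hom.hom m = 0 := by
    change AdjoinOne.map f (AdjoinOne.of R a) • (show X.obj from e.inv.hom.hom m) = 0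
    rw [AdjoinOne.map_of, ha, map_zero, zero_smul]
  have h' : e.hom.hom.hom (e.inv.hom.hom m) = m :=
    congrArg (fun k => k.hom m) (ObjectProperty.isoInv_hom_id_hom e)
  rw [← h', ← map_smul, h, map_zero]

theorem isZero_iff [HasLocalUnits R] (X : UnitalModuleCat.{u, x} R) :
    IsZero X ↔ ∀ m : X.obj, m = 0 := by
  constructor
  · intro h m
    have : (𝟙 X : X ⟶ X) = ObjectProperty.homMk 0 := h.eq_of_src _ _
    exact congrArg (fun k => k.hom.hom m) this
  · intro h
    refine ⟨fun Y => ⟨⟨⟨ObjectProperty.homMk 0⟩, fun g => ?_⟩⟩,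
      fun Y => ⟨⟨⟨ObjectProperty.homMk 0⟩, fun g => ?_⟩⟩⟩
    · refine ObjectProperty.hom_ext _ (ModuleCat.hom_ext (LinearMap.ext fun m => ?_))
      change g.hom.hom m = 0
      rw [h m, map_zero]
    · refine ObjectProperty.hom_ext _ (ModuleCat.hom_ext (LinearMap.ext fun m => ?_))
      exact h _

/-- The unital part of the restriction of Y is f(u)Y: if am = m then um = uam = am = m. -/
theorem isZero_unitalRestrictScalars_iff [HasLocalUnits R] [HasLocalUnits R'] {u : R}
    (hu : ∀ a, u * a = a) (Y : UnitalModuleCat.{u, u} R') :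
    IsZero ((unitalRestrictScalars f).obj Y) ↔ ∀ m : Y.obj, AdjoinOne.of R' (f u) • m = 0 := by
  rw [isZero_iff]
  let N := (ModuleCat.restrictScalars (AdjoinOne.map f)).obj Y.obj
  have key : ∀ (a : R) (m : N), AdjoinOne.of R a • m = AdjoinOne.of R' (f a) • (show Y.obj from m) := by
    intro a m
    rw [← AdjoinOne.map_of]
    rfl
  constructor
  · intro h m
    refine (key u m).symm.trans ?_
    refine congrArg Subtype.val (h (⟨AdjoinOne.of R u • (show N from m), mem_unitalSubmodule.2 ⟨u, ?_⟩⟩ :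
      unitalSubmodule N))
    rw [← mul_smul, ← map_mul, hu]
  · rintro h ⟨m, a, ha⟩
    refine Subtype.ext ?_
    change m = 0
    have ha : AdjoinOne.of R a • (show N from m) = m := ha
    have h : AdjoinOne.of R u • (show N from m) = 0 := (key u m).trans (h m)
    rw [← ha, ← hu a, map_mul, mul_smul, ha, h]

theorem isIso_of_bijective [HasLocalUnits R] {X Y : UnitalModuleCat.{u, x} R} (g : X ⟶ Y)
    (hg : Function.Bijective g.hom.hom) : IsIso g := by
  rw [← ObjectProperty.isIso_hom_iff, ConcreteCategory.isIso_iff_bijective]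
  exact hg

/-- If `R` is identified with a corner `εR'ε`, then coextension of scalars is fully faithful. -/
theorem isIso_unitalRestrictCoextendScalarsAdj_counit [HasLocalUnits R] [HasLocalUnits R'] {u : R}
    (hu : ∀ a, u * a = a) (hu' : ∀ a, a * u = a) (hf : Function.Injective f)
    (hcorner : ∀ b, ∃ a, f a = f u * b * f u) :
    IsIso (unitalRestrictCoextendScalarsAdj f hu hu').counit := by
  refine @NatIso.isIso_of_isIso_app _ _ _ _ _ _ _ fun N => ?_
  -- The counit evaluates a function at 1.
  have happ : ∀ y, ((unitalRestrictCoextendScalarsAdj f hu hu').counit.app N).hom.hom y =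
      (ModuleCat.CoextendScalars.equiv _ _ y.1.1) (1 : AdjoinOne R') := fun y => rfl
  let N' : ModuleCat.{u} (AdjoinOne R) := N.obj
  let S : ModuleCat.{u} (AdjoinOne R) :=
    (ModuleCat.restrictScalars (AdjoinOne.map f)).obj (ModuleCat.of _ (AdjoinOne R'))
  let ε : AdjoinOne R' := AdjoinOne.of R' (f u)
  have hε : ε * ε = ε := by rw [← map_mul, ← map_mul, hu]
  have hcomm : ∀ t, ε * AdjoinOne.map f t = AdjoinOne.map f t * ε := fun t => by
    obtain ⟨z, a, rfl⟩ := AdjoinOne.exists_eq t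
    simp only [ε, ← AdjoinOne.map_of, ← map_mul, mul_add, add_mul, hu, hu', mul_smul_comm,
      smul_mul_assoc, one_mul, mul_one]
  -- The compression s ↦ εsε takes values in the image of R even on ℤ ⊕ R'. The resulting map c from
  -- ℤ ⊕ R' to R is linear for left multiplication by ℤ ⊕ R and satisfies c(sε) = c(s) and c(1) = u.
  have hcorner' : ∀ s, ∃ a, AdjoinOne.of R' (f a) = ε * s * ε := fun s => by
    obtain ⟨b, hb⟩ := AdjoinOne.exists_mul_of s (f u)
    obtain ⟨a, ha⟩ := hcorner b
    refine ⟨a, ?_⟩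
    rw [ha, map_mul, map_mul, ← hb]
    simp only [ε, mul_assoc, ← map_mul, hu]
  choose c hc using hcorner'
  have hinj : ∀ {a b}, AdjoinOne.of R' (f a) = AdjoinOne.of R' (f b) → a = b := fun h =>
    hf (AdjoinOne.of_injective h)
  have hadd : ∀ s t, c (s + t) = c s + c t := fun s t => hinj <| by
    rw [map_add, map_add, hc, hc, hc, ← add_mul, ← mul_add]
  have hmul : ∀ t s, AdjoinOne.of R (c (AdjoinOne.map f t * s)) = t * AdjoinOne.of R (c s) := by
    intro t s
    obtain ⟨b, hb⟩ := AdjoinOne.exists_mul_of t (c s)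
    rw [hb]
    refine congrArg _ (hinj ?_)
    rw [hc, ← AdjoinOne.map_of f b, ← hb, map_mul, AdjoinOne.map_of, hc]
    simp only [← mul_assoc, hcomm]
  have hcε : ∀ s, c (s * ε) = c s := fun s => hinj <| by
    rw [hc, hc, mul_assoc, mul_assoc, hε, mul_assoc]
  have hcone : c 1 = u := hinj (by rw [hc, mul_one, hε])
  have hN : ∀ n : N', AdjoinOne.of R u • n = n := smul_eq_of_left_identity N.property hu
  have hsmul : ∀ (h : S →ₗ[AdjoinOne R] N') (t : AdjoinOne R) (s : AdjoinOne R'),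
      h (AdjoinOne.map f t * s : AdjoinOne R') = t • h s := fun h t s => h.map_smul t s
  refine isIso_of_bijective _ ⟨?_, ?_⟩
  · refine (injective_iff_map_eq_zero
      ((unitalRestrictCoextendScalarsAdj f hu hu').counit.app N).hom.hom).2 fun y hy => ?_
    rw [happ] at hy
    let h : S →ₗ[AdjoinOne R] N' := ModuleCat.CoextendScalars.equiv _ _ y.1.1
    -- Scalars act on the coextension by right translation of the argument, and y, lying in a unital
    -- module over R, is fixed by u.
    have hε' : ∀ s : AdjoinOne R', h (s * ε : AdjoinOne R') = h s := fun s => by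
      have h₁ := smul_eq_of_left_identity
        ((coextendScalars f ⋙ unitalRestrictScalars f).obj N).property hu y
      have h₂ := congrArg (fun y => (ModuleCat.CoextendScalars.equiv _ _ y.1.1) s) h₁
      refine Eq.trans ?_ h₂
      change h (s * ε : AdjoinOne R') = h (s * AdjoinOne.map f (AdjoinOne.of R u) : AdjoinOne R')
      rw [AdjoinOne.map_of]
    -- The value at 1 determines h: h(s) = u h(s) = h(εs) = h(εsε) = c(s) h(1).
    have hzero : ∀ s : AdjoinOne R', h s = 0 := fun s => by
      have h₁ : h s = h (ε * s * ε : AdjoinOne R') := by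
        rw [hε', ← hN (h s), ← hsmul, AdjoinOne.map_of]
      rw [h₁, ← hc, ← mul_one (AdjoinOne.of R' (f _)), ← AdjoinOne.map_of, hsmul]
      exact (congrArg _ hy).trans (smul_zero _)
    exact Subtype.ext (Subtype.ext (LinearMap.ext hzero))
  · intro n
    -- By the formula for injectivity, s ↦ c(s)n is the only candidate for a preimage of n.
    let h : S →ₗ[AdjoinOne R] N' :=
      { toFun := fun s => AdjoinOne.of R (c s) • (show N' from n)
        map_add' := fun s t => by
          rw [← add_smul, ← map_add]
          exact congrArg (AdjoinOne.of R · • (show N' from n)) (hadd s t)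
        map_smul' := fun t s => by
          rw [RingHom.id_apply, ← mul_smul]
          exact congrArg (· • (show N' from n)) (hmul t s) }
    have hε' : ∀ s : AdjoinOne R', h (s * ε : AdjoinOne R') = h s := fun s => by
      change AdjoinOne.of R (c (s * ε)) • (show N' from n) = AdjoinOne.of R (c s) • (show N' from n)
      rw [hcε]
    let y₀ := (ModuleCat.CoextendScalars.equiv (AdjoinOne.map f) N.obj).symm h
    -- Being fixed by ε = f(u) puts the function into the unital part over R', and then into the
    -- unital part of its restriction to R.
    have hy₀ : ε • y₀ = y₀ := ModuleCat.CoextendScalars.ext (LinearMap.ext hε')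
    let y₁ : unitalSubmodule ((ModuleCat.coextendScalars (AdjoinOne.map f)).obj N.obj) :=
      ⟨y₀, mem_unitalSubmodule.2 ⟨f u, hy₀⟩⟩
    let W := (ModuleCat.restrictScalars (AdjoinOne.map f)).obj ((coextendScalars f).obj N).obj
    have hy₁ : AdjoinOne.of R u • (show W from y₁) = y₁ := by
      refine Subtype.ext (Eq.trans ?_ hy₀)
      change AdjoinOne.map f (AdjoinOne.of R u) • y₀ = _
      rw [AdjoinOne.map_of]
    refine ⟨(⟨y₁, mem_unitalSubmodule.2 ⟨u, hy₁⟩⟩ : unitalSubmodule W), ?_⟩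
    refine (happ _).trans ?_
    change AdjoinOne.of R (c 1) • (show N' from n) = n
    rw [hcone, hN]

/-- The recollement of module categories given by a corner `T = εRε` of a ring `R` with local units
and the quotient `Q` of `R` by the ideal generated by `ε`. -/
theorem nonempty_recollement {R T Q : Type u} [NonUnitalRing R] [NonUnitalRing T]
    [NonUnitalRing Q] [HasLocalUnits R] [HasLocalUnits T] [HasLocalUnits Q]
    (φ : T →ₙ+* R) (hφ : Function.Injective φ) {u : T} (hu : ∀ a, u * a = a) (hu' : ∀ a, a * u = a)
    (hcorner : ∀ b, ∃ a, φ a = φ u * b * φ u)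
    (π : R →ₙ+* Q) (hπ : Function.Surjective π) (hπu : π (φ u) = 0)
    (hker : ∀ J : TwoSidedIdeal R, φ u ∈ J → ∀ a, π a = 0 → a ∈ J) :
    Nonempty (Recollement (UnitalModuleCat.{u, u} Q) (UnitalModuleCat.{u, u} R)
      (UnitalModuleCat.{u, u} T)) := by
  have hiso := isIso_unitalRestrictCoextendScalarsAdj_counit φ hu hu' hφ hcorner
  have hρ : (coextendScalars φ).FullyFaithful :=
    (unitalRestrictCoextendScalarsAdj φ hu hu').fullyFaithfulROfIsIsoCounit
  -- In an adjoint triple, one outer functor is fully faithful exactly when the other is.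
  have hσ : (extendScalars φ).FullyFaithful :=
    (Adjunction.Triple.mk (extendUnitalRestrictScalarsAdj φ)
      (unitalRestrictCoextendScalarsAdj φ hu hu')).fullyFaithfulEquiv.symm hρ
  refine ⟨{
    i := restrictScalars π hπ
    q := extendScalars π
    p := coextendScalars π
    j := unitalRestrictScalars φ
    s := extendScalars φ
    r := coextendScalars φ
    adj_qi := extendRestrictScalarsAdj π hπ
    adj_ip := restrictCoextendScalarsAdj π hπ
    adj_sj := extendUnitalRestrictScalarsAdj φ
    adj_jr := unitalRestrictCoextendScalarsAdj φ hu hu'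
    i_full := inferInstance
    i_faithful := inferInstance
    s_full := hσ.full
    s_faithful := hσ.faithful
    r_full := hρ.full
    r_faithful := hρ.faithful
    essImage_i_iff := fun Y => ?_ }⟩
  rw [isZero_unitalRestrictScalars_iff φ hu]
  refine ⟨fun h => smul_eq_zero_of_essImage_restrictScalars π hπ h hπu, fun h => ?_⟩
  -- The annihilator of Y. It contains φ(u), hence the kernel of π, so Y is a module over Q.
  let J : TwoSidedIdeal R := TwoSidedIdeal.mk' {a | ∀ m : Y.obj, AdjoinOne.of R a • m = 0}
    (fun m => by rw [map_zero, zero_smul])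
    (fun ha hb m => by rw [map_add, add_smul, ha m, hb m, add_zero])
    (fun ha m => by rw [map_neg, neg_smul, ha m, neg_zero])
    (fun hb m => by rw [map_mul, mul_smul, hb m, smul_zero])
    (fun ha m => by rw [map_mul, mul_smul, ha])
  have hJ : ∀ a, a ∈ J ↔ ∀ m : Y.obj, AdjoinOne.of R a • m = 0 := fun a =>
    TwoSidedIdeal.mem_mk' _ _ _ _ _ _ _
  exact essImage_restrictScalars π hπ Y fun a ha => (hJ a).1 (hker J ((hJ _).2 h) a ha)

end UnitalModuleCat
namespace LeavittPathAlgebra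

/-! ### The universal property -/

section UniversalProperty

variable (K : Type u) [Field K] {E : DirectedGraph.{v, w}}

open Generator in
/-- A family of elements of a ring that satisfies the relations of the Leavitt path algebra of `E`
up to a relation `r`. -/
structure IsLeavittFamily {A : Type x} [NonUnitalRing A] (r : A → A → Prop)
    (F : Generator E → A) : Prop where
  vertex_mul_self (y : E.Vertex) : r (F (vertex y) * F (vertex y)) (F (vertex y))
  vertex_mul_vertex (y z : E.Vertex) (h : y ≠ z) : r (F (vertex y) * F (vertex z)) 0
  source_mul_edge (e : E.Edge) : r (F (vertex (E.s e)) * F (edge e)) (F (edge e))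
  edge_mul_range (e : E.Edge) : r (F (edge e) * F (vertex (E.r e))) (F (edge e))
  range_mul_ghost (e : E.Edge) : r (F (vertex (E.r e)) * F (ghost e)) (F (ghost e))
  ghost_mul_source (e : E.Edge) : r (F (ghost e) * F (vertex (E.s e))) (F (ghost e))
  ghost_mul_edge_self (e : E.Edge) : r (F (ghost e) * F (edge e)) (F (vertex (E.r e)))
  ghost_mul_edge (e f : E.Edge) (h : e ≠ f) : r (F (ghost e) * F (edge f)) 0
  sum_edge_mul_ghost (y : E.Vertex) (hfin : {e : E.Edge | E.s e = y}.Finite)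
    (hne : {e : E.Edge | E.s e = y}.Nonempty) :
    r (∑ e ∈ hfin.toFinset, F (edge e) * F (ghost e)) (F (vertex y))

variable {A : Type x} [NonUnitalRing A] [Module K A] [IsScalarTower K A A] [SMulCommClass K A A]

/-- The homomorphism from the free algebra given by the images of the generators. -/
noncomputable def freeLift (F : Generator E → A) : FreeAlg K E →ₙₐ[K] A :=
  MonoidAlgebra.liftMagma K (FreeSemigroup.lift F)

@[simp]
theorem freeLift_of (F : Generator E → A) (g : Generator E) :
    freeLift K F (FreeAlg.of K E g) = F g := by
  simp [freeLift, FreeAlg.of]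

-- Allowing a congruence in place of equality serves two purposes: the trivial congruence gives the
-- universal property `lift`, and the congruence of an ideal gives the kernel of the map to the
-- quotient graph.
variable {K} in
theorem IsLeavittFamily.freeLift_rel {r : RingCon A} (hr : ∀ (c : K) a b, r a b → r (c • a) (c • b))
    {F : Generator E → A} (hF : IsLeavittFamily r F) {a b : FreeAlg K E} (h : con K E a b) :
    r (freeLift K F a) (freeLift K F b) := by
  replace h : RingConGen.Rel (Rel K E) a b := h
  induction h with
  | of a b h =>
    induction h with
    | vertex_mul_self y => simpa using hF.vertex_mul_self y
    | vertex_mul_vertex y z h => simpa using hF.vertex_mul_vertex y z h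
    | source_mul_edge e => simpa using hF.source_mul_edge e
    | edge_mul_range e => simpa using hF.edge_mul_range e
    | range_mul_ghost e => simpa using hF.range_mul_ghost e
    | ghost_mul_source e => simpa using hF.ghost_mul_source e
    | ghost_mul_edge_self e => simpa using hF.ghost_mul_edge_self e
    | ghost_mul_edge e f h => simpa using hF.ghost_mul_edge e f h
    | sum_edge_mul_ghost y hfin hne => simpa using hF.sum_edge_mul_ghost y hfin hne
    | smul c _ ih => simpa only [map_smul] using hr c _ _ ih
  | refl a => exact r.refl _
  | symm _ ih => exact r.symm ih
  | trans _ _ ih₁ ih₂ => exact r.trans ih₁ ih₂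
  | add _ _ ih₁ ih₂ => simpa only [map_add] using r.add ih₁ ih₂
  | mul _ _ ih₁ ih₂ => simpa only [map_mul] using r.mul ih₁ ih₂

theorem mk_eq_mk {a b : FreeAlg K E} : mk K E a = mk K E b ↔ con K E a b := RingCon.eq _

/-- The universal property of the Leavitt path algebra. -/
noncomputable def lift (F : Generator E → A) (hF : IsLeavittFamily Eq F) :
    LeavittPathAlgebra K E →ₙₐ[K] A where
  toFun := Quotient.lift (freeLift K F) fun _ _ h => by
    have h' := IsLeavittFamily.freeLift_rel (K := K) (r := ⊥) (F := F)
      (fun c a b hab => by rw [RingCon.coe_bot] at hab ⊢; rw [hab]) (by rwa [RingCon.coe_bot]) h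
    rwa [RingCon.coe_bot] at h'
  map_smul' c a := by
    obtain ⟨a, rfl⟩ := mk_surjective K E a
    exact map_smul (freeLift K F) c a
  map_zero' := map_zero (freeLift K F)
  map_add' a b := by
    obtain ⟨a, rfl⟩ := mk_surjective K E a
    obtain ⟨b, rfl⟩ := mk_surjective K E b
    exact map_add (freeLift K F) a b
  map_mul' a b := by
    obtain ⟨a, rfl⟩ := mk_surjective K E a
    obtain ⟨b, rfl⟩ := mk_surjective K E b
    exact map_mul (freeLift K F) a b

@[simp]
theorem lift_gen (F : Generator E → A) (hF : IsLeavittFamily Eq F) (g : Generator E) :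
    lift K F hF (gen K E g) = F g :=
  freeLift_of K F g

variable (E)

theorem isLeavittFamily_gen : IsLeavittFamily Eq (gen K E) where
  vertex_mul_self y := mk_eq_of_rel K E (.vertex_mul_self y)
  vertex_mul_vertex y z h := mk_eq_of_rel K E (.vertex_mul_vertex y z h)
  source_mul_edge e := mk_eq_of_rel K E (.source_mul_edge e)
  edge_mul_range e := mk_eq_of_rel K E (.edge_mul_range e)
  range_mul_ghost e := mk_eq_of_rel K E (.range_mul_ghost e)
  ghost_mul_source e := mk_eq_of_rel K E (.ghost_mul_source e)
  ghost_mul_edge_self e := mk_eq_of_rel K E (.ghost_mul_edge_self e)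
  ghost_mul_edge e f h := mk_eq_of_rel K E (.ghost_mul_edge e f h)
  sum_edge_mul_ghost y hfin hne := by
    simpa [map_sum, gen] using mk_eq_of_rel K E (.sum_edge_mul_ghost y hfin hne)

variable {K E}

theorem induction {p : LeavittPathAlgebra K E → Prop} (zero : p 0)
    (add : ∀ a b, p a → p b → p (a + b)) (smul : ∀ (c : K) a, p a → p (c • a))
    (mul : ∀ a b, p a → p b → p (a * b)) (gen : ∀ g, p (gen K E g)) (a) : p a := by
  obtain ⟨a, rfl⟩ := mk_surjective K E a
  induction a using MonoidAlgebra.induction_linear with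
  | zero => simpa using zero
  | add a b ha hb => simpa using add _ _ ha hb
  | single g c =>
    have e : mk K E (.single g c) = c • mk K E (.single g 1) := by
      rw [← mk_smul, MonoidAlgebra.smul_single, smul_eq_mul, mul_one]
    rw [e]
    refine smul c _ ?_
    clear e
    induction g using FreeSemigroup.recOnMul with
    | ih1 g => exact gen g
    | ih2 g g' hg hg' =>
      have e : mk K E (.single (FreeSemigroup.of g * g') 1) =
          mk K E (.single (FreeSemigroup.of g) 1) * mk K E (.single g' 1) := by
        rw [← map_mul, MonoidAlgebra.single_mul_single, one_mul]
      rw [e]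
      exact mul _ _ hg hg'

/-- With a local unit e of a, ca = (ce)a, so ring ideals are automatically K-subspaces. -/
theorem smul_mem_of_mem (J : TwoSidedIdeal (LeavittPathAlgebra K E)) (c : K)
    {a : LeavittPathAlgebra K E} (ha : a ∈ J) : c • a ∈ J := by
  obtain ⟨e, -, he⟩ := HasLocalUnits.exists_unit ({a} : Finset (LeavittPathAlgebra K E))
  rw [← (he a (by simp)).1, ← smul_mul_assoc]
  exact J.mul_mem_left _ _ ha

/-- Each element is fixed by all sufficiently large vertex sums, hence by the largest one. -/
theorem vertexSum_univ_mul [Fintype E.Vertex] (a : LeavittPathAlgebra K E) :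
    vertexSum K E Finset.univ * a = a ∧ a * vertexSum K E Finset.univ = a := by
  obtain ⟨a, rfl⟩ := mk_surjective K E a
  obtain ⟨F₀, h⟩ := exists_unit_mk K E a
  exact h _ (Finset.subset_univ _)

end UniversalProperty

end LeavittPathAlgebra
/-! ### The restriction graph and the corner -/

namespace LeavittPathAlgebra

open Generator

section Restriction

variable (K : Type u) [Field K] {E : DirectedGraph.{v, w}} {H : Set E.Vertex}
  (hH : E.IsHereditary H)

/-- A generator of the Leavitt path algebra of the restriction graph, as a generator of that of the
whole graph. -/
def restrictionGenerator : Generator (E.restriction H hH) → Generator E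
  | vertex y => vertex y.1
  | edge e => edge e.1
  | ghost e => ghost e.1

/-- A sum over the edges emitted by a vertex of the restriction graph. -/
theorem sum_restriction {A : Type*} [AddCommMonoid A] (y : (E.restriction H hH).Vertex)
    (hfin : {e : (E.restriction H hH).Edge | (E.restriction H hH).s e = y}.Finite)
    (hfin' : {e : E.Edge | E.s e = y.1}.Finite) (a : E.Edge → A) :
    ∑ e ∈ hfin.toFinset, a e.1 = ∑ e ∈ hfin'.toFinset, a e := by
  refine Finset.sum_nbij Subtype.val ?_ Subtype.val_injective.injOn ?_ fun _ _ => rfl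
  · intro e he
    simp only [Set.Finite.mem_toFinset, Set.mem_ofPred_eq] at he ⊢
    exact congrArg Subtype.val he
  · intro e he
    simp only [Set.Finite.coe_toFinset, Set.mem_ofPred_eq] at he ⊢
    exact ⟨⟨e, he ▸ y.2⟩, Subtype.ext he, rfl⟩

/-- Edges of E_H are selected by their source alone, so a vertex of H emits the same edges in both
graphs. The summation relation at such a vertex is therefore the same as well. -/
theorem finite_restriction_iff (y : (E.restriction H hH).Vertex) :
    {e : (E.restriction H hH).Edge | (E.restriction H hH).s e = y}.Finite ↔
      {e : E.Edge | E.s e = y.1}.Finite := by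
  refine (Set.finite_image_iff
    (Subtype.val_injective : Function.Injective (Subtype.val : _ → E.Edge)).injOn).symm.trans ?_
  refine Eq.to_iff (congrArg Set.Finite (Set.ext fun e => ⟨?_, fun he => ?_⟩))
  · rintro ⟨e, he, rfl⟩
    exact congrArg Subtype.val he
  · exact ⟨⟨e, (show E.s e = y.1 from he) ▸ y.2⟩, Subtype.ext he, rfl⟩

theorem isLeavittFamily_restriction :
    IsLeavittFamily Eq (gen K E ∘ restrictionGenerator hH) where
  vertex_mul_self y := (isLeavittFamily_gen K E).vertex_mul_self y.1
  vertex_mul_vertex y z h :=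
    (isLeavittFamily_gen K E).vertex_mul_vertex y.1 z.1 fun h' => h (Subtype.ext h')
  source_mul_edge e := (isLeavittFamily_gen K E).source_mul_edge e.1
  edge_mul_range e := (isLeavittFamily_gen K E).edge_mul_range e.1
  range_mul_ghost e := (isLeavittFamily_gen K E).range_mul_ghost e.1
  ghost_mul_source e := (isLeavittFamily_gen K E).ghost_mul_source e.1
  ghost_mul_edge_self e := (isLeavittFamily_gen K E).ghost_mul_edge_self e.1
  ghost_mul_edge e f h :=
    (isLeavittFamily_gen K E).ghost_mul_edge e.1 f.1 fun h' => h (Subtype.ext h')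
  sum_edge_mul_ghost y hfin hne := by
    have hfin' := (finite_restriction_iff hH y).1 hfin
    refine (sum_restriction hH y hfin hfin' fun e => gen K E (edge e) * gen K E (ghost e)).trans ?_
    refine (isLeavittFamily_gen K E).sum_edge_mul_ghost y.1 hfin' ?_
    obtain ⟨e, he⟩ := hne
    exact ⟨e.1, congrArg Subtype.val he⟩

/-- The homomorphism from the Leavitt path algebra of the restriction graph. -/
noncomputable def ofRestriction :
    LeavittPathAlgebra K (E.restriction H hH) →ₙₐ[K] LeavittPathAlgebra K E :=
  lift K _ (isLeavittFamily_restriction K hH)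

theorem ofRestriction_gen (g) :
    ofRestriction K hH (gen K _ g) = gen K E (restrictionGenerator hH g) :=
  lift_gen K _ _ g

/-! ### Injectivity

`L_K(E)` acts on functions from lists of edges to `L_K(E_H)`. Only the values on paths that run
outside `H` until they enter `H` with their last edge matter. -/

section PathAction

open Classical in
/-- The projection with which a vertex acts on the value of a function at a list of edges: the
final vertex if the list is a path that starts at the given vertex, and zero otherwise. -/
noncomputable def pathProj (y : E.Vertex) :
    List E.Edge → LeavittPathAlgebra K (E.restriction H hH)
  | [] => if h : y ∈ H then gen K (E.restriction H hH) (vertex ⟨y, h⟩) else 0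
  | e :: l => if E.s e = y ∧ y ∉ H then pathProj (E.r e) l else 0

/-- The endomorphism `x ↦ (l ↦ c(l)x(i(l)))` of a space of functions. -/
def monomialEnd {Λ T : Type*} [NonUnitalRing T] [Module K T] [SMulCommClass K T T] (c : Λ → T)
    (i : Λ → Λ) : Module.End K (Λ → T) where
  toFun x l := c l * x (i l)
  map_add' _ _ := funext fun _ => mul_add _ _ _
  map_smul' _ _ := funext fun _ => mul_smul_comm _ _ _

@[simp]
theorem monomialEnd_apply {Λ T : Type*} [NonUnitalRing T] [Module K T] [SMulCommClass K T T]
    (c : Λ → T) (i : Λ → Λ) (x : Λ → T) (l : Λ) : monomialEnd K c i x l = c l * x (i l) := rfl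

open Classical in
/-- The action of the generators of `L_K(E)` on functions on lists of edges. -/
noncomputable def pathAction :
    Generator E → Module.End K (List E.Edge → LeavittPathAlgebra K (E.restriction H hH))
  | vertex y => monomialEnd K (pathProj K hH y) id
  | edge e =>
    if h : E.s e ∈ H then
      monomialEnd K (fun | [] => gen K (E.restriction H hH) (edge ⟨e, h⟩) | _ :: _ => 0) id
    else monomialEnd K (fun | [] => 0 | f :: l => if f = e then pathProj K hH (E.r e) l else 0)
      List.tail
  | ghost e =>
    if h : E.s e ∈ H then
      monomialEnd K (fun | [] => gen K (E.restriction H hH) (ghost ⟨e, h⟩) | _ :: _ => 0) id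
    else monomialEnd K (pathProj K hH (E.r e)) (List.cons e)

theorem pathProj_nil {y : E.Vertex} (h : y ∈ H) :
    pathProj K hH y [] = gen K (E.restriction H hH) (vertex ⟨y, h⟩) := by
  simp [pathProj, h]

theorem pathProj_nil_of_notMem {y : E.Vertex} (h : y ∉ H) : pathProj K hH y [] = 0 := by
  simp [pathProj, h]

theorem pathProj_cons_of_mem {y : E.Vertex} (h : y ∈ H) (e l) : pathProj K hH y (e :: l) = 0 := by
  simp [pathProj, h]

open Classical in
theorem pathProj_cons_of_notMem {y : E.Vertex} (h : y ∉ H) (e l) :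
    pathProj K hH y (e :: l) = if E.s e = y then pathProj K hH (E.r e) l else 0 := by
  simp [pathProj, h]

theorem pathProj_mul_self (y : E.Vertex) (l : List E.Edge) :
    pathProj K hH y l * pathProj K hH y l = pathProj K hH y l := by
  induction l generalizing y with
  | nil =>
    rw [pathProj]
    split_ifs
    · exact (isLeavittFamily_gen K _).vertex_mul_self _
    · simp
  | cons e l ih =>
    rw [pathProj]
    split_ifs
    · exact ih _
    · simp

theorem pathProj_mul_of_ne {y z : E.Vertex} (h : y ≠ z) (l : List E.Edge) :
    pathProj K hH y l * pathProj K hH z l = 0 := by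
  cases l with
  | nil =>
    rw [pathProj, pathProj]
    split_ifs
    · exact (isLeavittFamily_gen K _).vertex_mul_vertex _ _ fun h' => h (congrArg Subtype.val h')
    all_goals simp
  | cons e l =>
    rw [pathProj, pathProj]
    split_ifs with h₁ h₂
    · exact absurd (h₁.1.symm.trans h₂.1) h
    all_goals simp

/-- A function x is to be read as a formal sum ∑ l x(l) over paths l that enter H with their last
edge, x(l) being a coefficient in L_K(E_H). Generators act by left multiplication: those of E_H act
on the coefficient of the empty path, an edge with source outside H is prepended to paths, and its
ghost edge removes it. Each relation can be checked at one list at a time. -/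
theorem isLeavittFamily_pathAction : IsLeavittFamily Eq (pathAction K hH) where
  vertex_mul_self y := by
    ext x l
    simp [pathAction, ← mul_assoc, pathProj_mul_self]
  vertex_mul_vertex y z h := by
    ext x l
    simp [pathAction, ← mul_assoc, pathProj_mul_of_ne K hH h]
  source_mul_edge e := by
    ext x l
    by_cases h : E.s e ∈ H
    · cases l with
      | nil =>
        simp only [pathAction, dif_pos h, Module.End.mul_apply, monomialEnd_apply, ← mul_assoc, id]
        rw [pathProj_nil K hH h]
        exact congrArg (· * _) ((isLeavittFamily_gen K _).source_mul_edge _)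
      | cons f l => simp [pathAction, h]
    · cases l with
      | nil => simp [pathAction, h]
      | cons f l =>
        by_cases hf : f = e
        · subst hf
          simp [pathAction, h, pathProj_cons_of_notMem, ← mul_assoc, pathProj_mul_self]
        · simp [pathAction, h, hf]
  edge_mul_range e := by
    ext x l
    by_cases h : E.s e ∈ H
    · cases l with
      | nil =>
        simp only [pathAction, dif_pos h, Module.End.mul_apply, monomialEnd_apply, ← mul_assoc, id]
        rw [pathProj_nil K hH (hH e h)]
        exact congrArg (· * _) ((isLeavittFamily_gen K (E.restriction H hH)).edge_mul_range ⟨e, h⟩)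
      | cons f l => simp [pathAction, h]
    · cases l with
      | nil => simp [pathAction, h]
      | cons f l =>
        by_cases hf : f = e
        · simp [pathAction, h, hf, ← mul_assoc, pathProj_mul_self]
        · simp [pathAction, h, hf]
  range_mul_ghost e := by
    ext x l
    by_cases h : E.s e ∈ H
    · cases l with
      | nil =>
        simp only [pathAction, dif_pos h, Module.End.mul_apply, monomialEnd_apply, ← mul_assoc, id]
        rw [pathProj_nil K hH (hH e h)]
        exact congrArg (· * _) ((isLeavittFamily_gen K (E.restriction H hH)).range_mul_ghost ⟨e, h⟩)
      | cons f l => simp [pathAction, h]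
    · simp [pathAction, h, ← mul_assoc, pathProj_mul_self]
  ghost_mul_source e := by
    ext x l
    by_cases h : E.s e ∈ H
    · cases l with
      | nil =>
        simp only [pathAction, dif_pos h, Module.End.mul_apply, monomialEnd_apply, ← mul_assoc, id]
        rw [pathProj_nil K hH h]
        exact congrArg (· * _) ((isLeavittFamily_gen K _).ghost_mul_source _)
      | cons f l => simp [pathAction, h]
    · simp [pathAction, h, pathProj_cons_of_notMem, ← mul_assoc, pathProj_mul_self]
  ghost_mul_edge_self e := by
    ext x l
    by_cases h : E.s e ∈ H
    · cases l with
      | nil =>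
        simp only [pathAction, dif_pos h, Module.End.mul_apply, monomialEnd_apply, ← mul_assoc, id]
        rw [pathProj_nil K hH (hH e h)]
        exact congrArg (· * _)
          ((isLeavittFamily_gen K (E.restriction H hH)).ghost_mul_edge_self ⟨e, h⟩)
      | cons f l => simp [pathAction, h, pathProj_cons_of_mem K hH (hH e h)]
    · simp [pathAction, h, ← mul_assoc, pathProj_mul_self]
  ghost_mul_edge e f hef := by
    ext x l
    by_cases h : E.s e ∈ H <;> by_cases h' : E.s f ∈ H
    · cases l with
      | nil =>
        simp only [pathAction, dif_pos h, dif_pos h', Module.End.mul_apply, monomialEnd_apply,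
          ← mul_assoc, id]
        rw [(isLeavittFamily_gen K (E.restriction H hH)).ghost_mul_edge ⟨e, h⟩ ⟨f, h'⟩
          fun h => hef (congrArg Subtype.val h)]
        simp
      | cons f l => simp [pathAction, h, h']
    · cases l <;> simp [pathAction, h, h']
    · simp [pathAction, h, h']
    · simp [pathAction, h, h', hef]
  sum_edge_mul_ghost y hfin hne := by
    classical
    ext x l
    rw [LinearMap.sum_apply, Finset.sum_apply]
    by_cases hy : y ∈ H
    · have hs : ∀ e ∈ hfin.toFinset, E.s e ∈ H := fun e he => by
        rw [Set.Finite.mem_toFinset, Set.mem_ofPred_eq] at he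
        rwa [he]
      cases l with
      | nil =>
        -- At the empty list this is the summation relation of E_H at y.
        have hfin' := (finite_restriction_iff hH ⟨y, hy⟩).2 hfin
        have hsum := (isLeavittFamily_gen K (E.restriction H hH)).sum_edge_mul_ghost ⟨y, hy⟩ hfin' (by
          obtain ⟨e, he⟩ := hne
          exact ⟨⟨e, (show E.s e = y from he) ▸ hy⟩, Subtype.ext he⟩)
        have hsum' := sum_restriction hH ⟨y, hy⟩ hfin' hfin fun e =>
          (pathAction K hH (edge e) * pathAction K hH (ghost e)) x []
        rw [← hsum']
        simp only [pathAction, monomialEnd_apply, pathProj_nil K hH hy, ← hsum, Finset.sum_mul]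
        refine Finset.sum_congr rfl fun e _ => ?_
        simp only [dif_pos e.2, Module.End.mul_apply, monomialEnd_apply, ← mul_assoc, id]
        rfl
      | cons f l =>
        rw [Finset.sum_eq_zero]
        · simp [pathAction, pathProj_cons_of_mem K hH hy]
        · intro e he
          simp [pathAction, hs e he]
    · have hs : ∀ e ∈ hfin.toFinset, E.s e ∉ H := fun e he => by
        rw [Set.Finite.mem_toFinset, Set.mem_ofPred_eq] at he
        rwa [he]
      cases l with
      | nil =>
        rw [Finset.sum_eq_zero]
        · simp [pathAction, pathProj_nil_of_notMem K hH hy]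
        · intro e he
          simp [pathAction, hs e he]
      | cons f l =>
        -- The operator ee* retains only the lists beginning with e, so a single summand survives at
        -- f :: l.
        have : ∀ e ∈ hfin.toFinset, (pathAction K hH (edge e) * pathAction K hH (ghost e)) x (f :: l)
            = if f = e then pathProj K hH (E.r f) l * x (f :: l) else 0 := by
          intro e he
          by_cases hf : f = e
          · subst hf
            simp [pathAction, hs f he, ← mul_assoc, pathProj_mul_self]
          · simp [pathAction, hs e he, hf]
        rw [Finset.sum_congr rfl this, Finset.sum_ite_eq]
        simp [pathAction, pathProj_cons_of_notMem K hH hy]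

/-- The value at the empty list carries the left regular representation of L_K(E_H), which is what
injectivity requires. -/
theorem pathAction_ofRestriction (a : LeavittPathAlgebra K (E.restriction H hH)) :
    ∀ x, lift K _ (isLeavittFamily_pathAction K hH) (ofRestriction K hH a) x [] = a * x [] := by
  induction a using induction with
  | zero => simp
  | add a b ha hb => simp [add_mul, ha, hb]
  | smul c a ha => simp [ha, smul_mul_assoc]
  | mul a b ha hb => simp [mul_assoc, ha, hb]
  | gen g =>
    intro x
    rw [ofRestriction_gen, lift_gen]
    cases g with
    | vertex y =>
      simp only [restrictionGenerator, pathAction, monomialEnd_apply, pathProj_nil K hH y.2, id]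
      rfl
    | edge e => simp only [restrictionGenerator, pathAction, dif_pos e.2, monomialEnd_apply, id]; rfl
    | ghost e => simp only [restrictionGenerator, pathAction, dif_pos e.2, monomialEnd_apply, id]; rfl

end PathAction

theorem ofRestriction_injective : Function.Injective (ofRestriction K hH) := by
  refine (injective_iff_map_eq_zero _).2 fun a ha => ?_
  obtain ⟨e, -, he⟩ :=
    HasLocalUnits.exists_unit ({a} : Finset (LeavittPathAlgebra K (E.restriction H hH)))
  rw [← (he a (by simp)).2]
  -- Applied to the constant function e with ae = a, the action of the image of a has value ae = a
  -- at the empty list.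
  have := pathAction_ofRestriction K hH a fun _ => e
  rw [ha, map_zero] at this
  exact this.symm

end Restriction

end LeavittPathAlgebra
namespace LeavittPathAlgebra

open Generator

/-! ### The image of L_K(E_H) is the corner εRε -/

section Corner

variable (K : Type u) [Field K] {E : DirectedGraph.{v, w}} {H : Set E.Vertex}
  (hH : E.IsHereditary H)

/-- The elements `a e₁* ⋯ eₙ*` with `a` in the image of the Leavitt path algebra of `E_H`. -/
inductive IsCornerWord : LeavittPathAlgebra K E → Prop
  | base (a) : IsCornerWord (ofRestriction K hH a)
  | mul_ghost (x) (e : E.Edge) : IsCornerWord x → IsCornerWord (x * gen K E (ghost e))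

variable {K hH} in
theorem IsCornerWord.zero : IsCornerWord K hH 0 := by
  simpa using IsCornerWord.base (K := K) (hH := hH) 0

variable [Fintype (E.restriction H hH).Vertex]

/-- The idempotent `∑_{y ∈ H} y` as an element of the Leavitt path algebra of `E_H`. -/
local notation "𝟙H" => vertexSum K (E.restriction H hH) Finset.univ

theorem vertex_mul_cornerUnit {y : E.Vertex} (hy : y ∈ H) :
    gen K E (vertex y) * ofRestriction K hH 𝟙H = gen K E (vertex y) := by
  have := ofRestriction_gen K hH (vertex ⟨y, hy⟩)
  rw [show gen K E (vertex y) = _ from this.symm, ← map_mul, (vertexSum_univ_mul _).2]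

theorem vertex_mul_cornerUnit_of_notMem {y : E.Vertex} (hy : y ∉ H) :
    gen K E (vertex y) * ofRestriction K hH 𝟙H = 0 := by
  rw [vertexSum, map_sum, Finset.mul_sum]
  refine Finset.sum_eq_zero fun z _ => ?_
  rw [ofRestriction_gen]
  exact (isLeavittFamily_gen K E).vertex_mul_vertex _ _ fun h => hy (h ▸ z.2)

theorem cornerUnit_mul_vertex_of_notMem {y : E.Vertex} (hy : y ∉ H) :
    ofRestriction K hH 𝟙H * gen K E (vertex y) = 0 := by
  rw [vertexSum, map_sum, Finset.sum_mul]
  refine Finset.sum_eq_zero fun z _ => ?_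
  rw [ofRestriction_gen]
  exact (isLeavittFamily_gen K E).vertex_mul_vertex _ _ fun h => hy (h ▸ z.2)

variable {K hH}

theorem IsCornerWord.mul_vertex {x : LeavittPathAlgebra K E} (hx : IsCornerWord K hH x)
    (y : E.Vertex) : IsCornerWord K hH (x * gen K E (vertex y)) := by
  cases hx with
  | base a =>
    by_cases hy : y ∈ H
    · have := ofRestriction_gen K hH (vertex ⟨y, hy⟩)
      rw [show gen K E (vertex y) = _ from this.symm, ← map_mul]
      exact .base _
    · rw [← (vertexSum_univ_mul a).2, map_mul, mul_assoc, cornerUnit_mul_vertex_of_notMem K hH hy,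
        mul_zero]
      exact .zero
  | mul_ghost x e hx =>
    rw [mul_assoc]
    by_cases h : E.s e = y
    · rw [← h, (isLeavittFamily_gen K E).ghost_mul_source]
      exact .mul_ghost x e hx
    · rw [← (isLeavittFamily_gen K E).ghost_mul_source, mul_assoc,
        (isLeavittFamily_gen K E).vertex_mul_vertex _ _ h, mul_zero, mul_zero]
      exact .zero

/-- A final ghost edge either cancels against f, by e*f = r(e), or annihilates it. If none is left,
f belongs to E_H when it starts in H; otherwise a = aε and ε s(f) = 0 give af = 0. -/
theorem IsCornerWord.mul_edge {x : LeavittPathAlgebra K E} (hx : IsCornerWord K hH x)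
    (f : E.Edge) : IsCornerWord K hH (x * gen K E (edge f)) := by
  cases hx with
  | base a =>
    by_cases hf : E.s f ∈ H
    · have := ofRestriction_gen K hH (edge ⟨f, hf⟩)
      rw [show gen K E (edge f) = _ from this.symm, ← map_mul]
      exact .base _
    · rw [← (vertexSum_univ_mul a).2, map_mul, ← (isLeavittFamily_gen K E).source_mul_edge,
        ← mul_assoc, mul_assoc (ofRestriction K hH a), cornerUnit_mul_vertex_of_notMem K hH hf,
        mul_zero, zero_mul]
      exact .zero
  | mul_ghost x e hx =>
    rw [mul_assoc]
    by_cases h : e = f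
    · rw [← h, (isLeavittFamily_gen K E).ghost_mul_edge_self]
      exact hx.mul_vertex _
    · rw [(isLeavittFamily_gen K E).ghost_mul_edge _ _ h, mul_zero]
      exact .zero

theorem IsCornerWord.mul_gen {x : LeavittPathAlgebra K E} (hx : IsCornerWord K hH x)
    (g : Generator E) : IsCornerWord K hH (x * gen K E g) := by
  cases g with
  | vertex y => exact hx.mul_vertex y
  | edge e => exact hx.mul_edge e
  | ghost e => exact .mul_ghost x e hx

/-- If s(e) is not in H then e*ε = e* s(e) ε = 0. If it is, e* comes from E_H and xe*ε = (xε)e*, so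
induction applies to xε. -/
theorem IsCornerWord.exists_mul_cornerUnit {x : LeavittPathAlgebra K E}
    (hx : IsCornerWord K hH x) : ∃ a, ofRestriction K hH a = x * ofRestriction K hH 𝟙H := by
  induction hx with
  | base a => exact ⟨a, by rw [← map_mul, (vertexSum_univ_mul a).2]⟩
  | mul_ghost x e _ ih =>
    by_cases h : E.s e ∈ H
    · obtain ⟨a, ha⟩ := ih
      refine ⟨a * gen K (E.restriction H hH) (ghost ⟨e, h⟩), ?_⟩
      have := ofRestriction_gen K hH (ghost ⟨e, h⟩)
      rw [show gen K E (ghost e) = _ from this.symm, map_mul, ha, mul_assoc, mul_assoc, ← map_mul,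
        ← map_mul, (vertexSum_univ_mul _).1, (vertexSum_univ_mul _).2]
    · refine ⟨0, ?_⟩
      rw [← (isLeavittFamily_gen K E).ghost_mul_source, mul_assoc, mul_assoc,
        vertex_mul_cornerUnit_of_notMem K hH h, mul_zero, mul_zero, map_zero]

variable (K hH)

/-- The image of the Leavitt path algebra of `E_H` is a corner. -/
theorem exists_ofRestriction_eq (b : LeavittPathAlgebra K E) :
    ∃ a, ofRestriction K hH a = ofRestriction K hH 𝟙H * b * ofRestriction K hH 𝟙H := by
  let M := Submodule.span K {x | IsCornerWord K hH x}
  -- The span of the words is stable under right multiplication and contains ε, so it contains εb.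
  have hM : ∀ x ∈ M, x * b ∈ M := by
    induction b using induction with
    | zero => simp
    | add a b ha hb => exact fun x hx => by rw [mul_add]; exact M.add_mem (ha x hx) (hb x hx)
    | smul c a ha => exact fun x hx => by rw [mul_smul_comm]; exact M.smul_mem c (ha x hx)
    | mul a b ha hb => exact fun x hx => by rw [← mul_assoc]; exact hb _ (ha x hx)
    | gen g =>
      intro x hx
      induction hx using Submodule.span_induction with
      | mem x hx => exact Submodule.subset_span (IsCornerWord.mul_gen hx g)
      | zero => simp
      | add x y _ _ hx hy => rw [add_mul]; exact M.add_mem hx hy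
      | smul c x _ hx => rw [smul_mul_assoc]; exact M.smul_mem c hx
  have := hM _ (Submodule.subset_span (IsCornerWord.base 𝟙H))
  generalize ofRestriction K hH 𝟙H * b = x at this
  induction this using Submodule.span_induction with
  | mem x hx => exact IsCornerWord.exists_mul_cornerUnit hx
  | zero => exact ⟨0, by simp⟩
  | add x y _ _ hx hy =>
    obtain ⟨a, ha⟩ := hx
    obtain ⟨b, hb⟩ := hy
    exact ⟨a + b, by rw [map_add, ha, hb, add_mul]⟩
  | smul c x _ hx =>
    obtain ⟨a, ha⟩ := hx
    exact ⟨c • a, by rw [map_smul, ha, smul_mul_assoc]⟩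

end Corner

/-! ### The quotient graph -/

section Quotient

variable (K : Type u) [Field K] {E : DirectedGraph.{v, w}} {X : Set E.Vertex}
  (hX : E.IsHereditary X)

open Classical in
/-- The images of the generators in the Leavitt path algebra of the quotient graph. -/
noncomputable def quotientGen : Generator E → LeavittPathAlgebra K (E.quotient X hX)
  | vertex y => if h : y ∈ X then 0 else gen K (E.quotient X hX) (vertex ⟨y, h⟩)
  | edge e => if h : E.r e ∈ X then 0 else gen K (E.quotient X hX) (edge ⟨e, h⟩)
  | ghost e => if h : E.r e ∈ X then 0 else gen K (E.quotient X hX) (ghost ⟨e, h⟩)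

/-- A sum over the edges emitted by a vertex of the quotient graph. -/
theorem sum_quotient {A : Type*} [AddCommMonoid A] (y : (E.quotient X hX).Vertex)
    (hfin : {e : (E.quotient X hX).Edge | (E.quotient X hX).s e = y}.Finite)
    (hfin' : {e : E.Edge | E.s e = y.1}.Finite) (a : E.Edge → A)
    (ha : ∀ e, E.s e = y.1 → E.r e ∈ X → a e = 0) :
    ∑ e ∈ hfin.toFinset, a e.1 = ∑ e ∈ hfin'.toFinset, a e := by
  refine Finset.sum_of_injOn Subtype.val Subtype.val_injective.injOn ?_ ?_ fun _ _ => rfl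
  · intro e he
    simp only [Set.Finite.coe_toFinset, Set.mem_ofPred_eq] at he ⊢
    exact congrArg Subtype.val he
  · intro e he h
    simp only [Set.Finite.mem_toFinset, Set.Finite.coe_toFinset, Set.mem_ofPred_eq] at he h
    refine ha e he (by_contra fun h' => h ⟨⟨e, h'⟩, Subtype.ext he, rfl⟩)

theorem finite_quotient {y : (E.quotient X hX).Vertex} (hfin : {e : E.Edge | E.s e = y.1}.Finite) :
    {e : (E.quotient X hX).Edge | (E.quotient X hX).s e = y}.Finite :=
  (hfin.preimage (f := (Subtype.val : (E.quotient X hX).Edge → E.Edge))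
    Subtype.val_injective.injOn).subset fun _ he => congrArg Subtype.val he

theorem isLeavittFamily_quotientGen (hsat : E.IsSaturated X) :
    IsLeavittFamily Eq (quotientGen K hX) where
  vertex_mul_self y := by
    by_cases h : y ∈ X
    · simp [quotientGen, h]
    · simpa [quotientGen, h] using (isLeavittFamily_gen K (E.quotient X hX)).vertex_mul_self ⟨y, h⟩
  vertex_mul_vertex y z hyz := by
    by_cases h : y ∈ X
    · simp [quotientGen, h]
    by_cases h' : z ∈ X
    · simp [quotientGen, h']
    simp only [quotientGen, dif_neg h, dif_neg h']
    exact (isLeavittFamily_gen K (E.quotient X hX)).vertex_mul_vertex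
      ⟨y, h⟩ ⟨z, h'⟩ fun h => hyz (congrArg Subtype.val h)
  source_mul_edge e := by
    by_cases h : E.r e ∈ X
    · simp [quotientGen, h]
    have h' : E.s e ∉ X := fun h' => h (hX e h')
    simp only [quotientGen, dif_neg h, dif_neg h']
    exact (isLeavittFamily_gen K (E.quotient X hX)).source_mul_edge ⟨e, h⟩
  edge_mul_range e := by
    by_cases h : E.r e ∈ X
    · simp [quotientGen, h]
    simp only [quotientGen, dif_neg h]
    exact (isLeavittFamily_gen K (E.quotient X hX)).edge_mul_range ⟨e, h⟩
  range_mul_ghost e := by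
    by_cases h : E.r e ∈ X
    · simp [quotientGen, h]
    simp only [quotientGen, dif_neg h]
    exact (isLeavittFamily_gen K (E.quotient X hX)).range_mul_ghost ⟨e, h⟩
  ghost_mul_source e := by
    by_cases h : E.r e ∈ X
    · simp [quotientGen, h]
    have h' : E.s e ∉ X := fun h' => h (hX e h')
    simp only [quotientGen, dif_neg h, dif_neg h']
    exact (isLeavittFamily_gen K (E.quotient X hX)).ghost_mul_source ⟨e, h⟩
  ghost_mul_edge_self e := by
    by_cases h : E.r e ∈ X
    · simp [quotientGen, h]
    simp only [quotientGen, dif_neg h]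
    exact (isLeavittFamily_gen K (E.quotient X hX)).ghost_mul_edge_self ⟨e, h⟩
  ghost_mul_edge e f hef := by
    by_cases h : E.r e ∈ X
    · simp [quotientGen, h]
    by_cases h' : E.r f ∈ X
    · simp [quotientGen, h']
    simp only [quotientGen, dif_neg h, dif_neg h']
    exact (isLeavittFamily_gen K (E.quotient X hX)).ghost_mul_edge
      ⟨e, h⟩ ⟨f, h'⟩ fun h => hef (congrArg Subtype.val h)
  sum_edge_mul_ghost y hfin hne := by
    by_cases hy : y ∈ X
    · rw [Finset.sum_eq_zero]
      · simp [quotientGen, hy]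
      · intro e he
        rw [Set.Finite.mem_toFinset, Set.mem_ofPred_eq] at he
        simp [quotientGen, hX e (he ▸ hy)]
    · have hfin' := finite_quotient hX (y := ⟨y, hy⟩) hfin
      rw [← sum_quotient hX ⟨y, hy⟩ hfin' hfin
        (fun e => quotientGen K hX (edge e) * quotientGen K hX (ghost e))
        fun e _ he => by simp [quotientGen, he]]
      -- Saturation: a vertex outside X that emits edges of E still emits one in E/X, so the
      -- summation relation is available there.
      have hne' : {e : (E.quotient X hX).Edge | (E.quotient X hX).s e = ⟨y, hy⟩}.Nonempty := by
        by_contra! hempty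
        refine hy (hsat y hfin hne fun e he => by_contra fun h => ?_)
        exact Set.eq_empty_iff_forall_notMem.1 hempty ⟨e, h⟩ (Subtype.ext he)
      simp only [quotientGen, dif_neg hy]
      rw [← (isLeavittFamily_gen K (E.quotient X hX)).sum_edge_mul_ghost ⟨y, hy⟩ hfin' hne']
      refine Finset.sum_congr rfl fun e _ => ?_
      rw [dif_neg e.2, dif_neg e.2]
      rfl

/-- The homomorphism to the Leavitt path algebra of the quotient graph. -/
noncomputable def toQuotient (hsat : E.IsSaturated X) :
    LeavittPathAlgebra K E →ₙₐ[K] LeavittPathAlgebra K (E.quotient X hX) :=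
  lift K _ (isLeavittFamily_quotientGen K hX hsat)

theorem toQuotient_surjective (hsat : E.IsSaturated X) :
    Function.Surjective (toQuotient K hX hsat) := by
  intro a
  induction a using induction with
  | zero => exact ⟨0, map_zero _⟩
  | add a b ha hb =>
    obtain ⟨a, rfl⟩ := ha
    obtain ⟨b, rfl⟩ := hb
    exact ⟨a + b, map_add _ _ _⟩
  | smul c a ha =>
    obtain ⟨a, rfl⟩ := ha
    exact ⟨c • a, map_smul _ _ _⟩
  | mul a b ha hb =>
    obtain ⟨a, rfl⟩ := ha
    obtain ⟨b, rfl⟩ := hb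
    exact ⟨a * b, map_mul _ _ _⟩
  | gen g =>
    cases g with
    | vertex y => exact ⟨gen K E (vertex y.1), (lift_gen K _ _ _).trans (dif_neg y.2)⟩
    | edge e => exact ⟨gen K E (edge e.1), (lift_gen K _ _ _).trans (dif_neg e.2)⟩
    | ghost e => exact ⟨gen K E (ghost e.1), (lift_gen K _ _ _).trans (dif_neg e.2)⟩

theorem toQuotient_vertex (hsat : E.IsSaturated X) {y : E.Vertex} (hy : y ∈ X) :
    toQuotient K hX hsat (gen K E (vertex y)) = 0 :=
  (lift_gen K _ _ _).trans (dif_pos hy)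

/-- The generators of the Leavitt path algebra of the quotient graph, as elements of that of the
whole graph. -/
noncomputable def quotientLift : Generator (E.quotient X hX) → LeavittPathAlgebra K E
  | vertex y => gen K E (vertex y.1)
  | edge e => gen K E (edge e.1)
  | ghost e => gen K E (ghost e.1)

theorem edge_mem {J : TwoSidedIdeal (LeavittPathAlgebra K E)} {e : E.Edge}
    (he : gen K E (vertex (E.r e)) ∈ J) : gen K E (edge e) ∈ J := by
  rw [← (isLeavittFamily_gen K E).edge_mul_range]
  exact J.mul_mem_left _ _ he

theorem ghost_mem {J : TwoSidedIdeal (LeavittPathAlgebra K E)} {e : E.Edge}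
    (he : gen K E (vertex (E.r e)) ∈ J) : gen K E (ghost e) ∈ J := by
  rw [← (isLeavittFamily_gen K E).range_mul_ghost]
  exact J.mul_mem_right _ _ he

theorem ringCon_of_eq (J : TwoSidedIdeal (LeavittPathAlgebra K E)) {a b : LeavittPathAlgebra K E}
    (h : a = b) : J.ringCon a b :=
  h ▸ J.ringCon.refl _

/-- Only the summation relation is affected by removing edges; the missing terms ee* have r(e) in X
and so lie in J. -/
theorem isLeavittFamily_quotientLift (hE : E.RowFinite)
    (J : TwoSidedIdeal (LeavittPathAlgebra K E)) (hJ : ∀ y ∈ X, gen K E (vertex y) ∈ J) :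
    IsLeavittFamily J.ringCon (quotientLift K hX) where
  vertex_mul_self y :=
    ringCon_of_eq K J ((isLeavittFamily_gen K E).vertex_mul_self y.1)
  vertex_mul_vertex y z h :=
    ringCon_of_eq K J ((isLeavittFamily_gen K E).vertex_mul_vertex y.1 z.1 fun h' => h (Subtype.ext h'))
  source_mul_edge e :=
    ringCon_of_eq K J ((isLeavittFamily_gen K E).source_mul_edge e.1)
  edge_mul_range e :=
    ringCon_of_eq K J ((isLeavittFamily_gen K E).edge_mul_range e.1)
  range_mul_ghost e :=
    ringCon_of_eq K J ((isLeavittFamily_gen K E).range_mul_ghost e.1)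
  ghost_mul_source e :=
    ringCon_of_eq K J ((isLeavittFamily_gen K E).ghost_mul_source e.1)
  ghost_mul_edge_self e :=
    ringCon_of_eq K J ((isLeavittFamily_gen K E).ghost_mul_edge_self e.1)
  ghost_mul_edge e f h :=
    ringCon_of_eq K J ((isLeavittFamily_gen K E).ghost_mul_edge e.1 f.1 fun h' => h (Subtype.ext h'))
  sum_edge_mul_ghost y hfin hne := by
    classical
    -- Row-finiteness is essential here: a vertex emitting infinitely many edges in E but only
    -- finitely many, and at least one, in E/X would satisfy a summation relation in E/X that has no
    -- counterpart in E.
    have hfin' := hE y.1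
    have hne' : {e : E.Edge | E.s e = y.1}.Nonempty := by
      obtain ⟨e, he⟩ := hne
      exact ⟨e.1, congrArg Subtype.val he⟩
    let a : E.Edge → LeavittPathAlgebra K E := fun e =>
      if E.r e ∈ X then 0 else gen K E (edge e) * gen K E (ghost e)
    have ha : ∑ e ∈ hfin.toFinset, quotientLift K hX (edge e) * quotientLift K hX (ghost e) =
        ∑ e ∈ hfin'.toFinset, a e := by
      rw [← sum_quotient hX y hfin hfin' a fun e _ he => if_pos he]
      exact Finset.sum_congr rfl fun e _ => (if_neg e.2).symm
    rw [ha]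
    change J.ringCon _ (gen K E (vertex y.1))
    rw [← (isLeavittFamily_gen K E).sum_edge_mul_ghost y.1 hfin' hne']
    refine J.ringCon.finsetSum _ fun e _ => ?_
    by_cases he : E.r e ∈ X
    · rw [show a e = 0 from if_pos he]
      exact J.ringCon.symm ((J.mem_iff _).1 (J.mul_mem_right _ _ (edge_mem K (hJ _ he))))
    · rw [show a e = _ from if_neg he]
      exact J.ringCon.refl _

/-- The kernel of the homomorphism to the Leavitt path algebra of the quotient graph is the ideal
generated by the vertices in `X`. -/
theorem mem_of_toQuotient_eq_zero (hE : E.RowFinite) (hsat : E.IsSaturated X)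
    (J : TwoSidedIdeal (LeavittPathAlgebra K E)) (hJ : ∀ y ∈ X, gen K E (vertex y) ∈ J)
    {b : LeavittPathAlgebra K E} (hb : toQuotient K hX hsat b = 0) : b ∈ J := by
  have hsmul : ∀ (c : K) x y, J.ringCon x y → J.ringCon (c • x) (c • y) := fun c x y h => by
    rw [TwoSidedIdeal.rel_iff] at h ⊢
    rw [← smul_sub]
    exact smul_mem_of_mem J c h
  -- Some expression a of the image of b in the generators of E/X becomes congruent to b modulo J
  -- when evaluated in L_K(E). If the image of b is zero, a is congruent to 0 under the relations of
  -- E/X, and these hold modulo J.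
  have key : ∃ a : FreeAlg K (E.quotient X hX), toQuotient K hX hsat b = mk K _ a ∧
      J.ringCon (freeLift K (quotientLift K hX) a) b := by
    clear hb
    induction b using induction with
    | zero => exact ⟨0, by simp, by simpa using J.ringCon.refl _⟩
    | add b b' h h' =>
      obtain ⟨a, ha, hr⟩ := h
      obtain ⟨a', ha', hr'⟩ := h'
      exact ⟨a + a', by rw [map_add, map_add, ha, ha'], by rw [map_add]; exact J.ringCon.add hr hr'⟩
    | smul c b h =>
      obtain ⟨a, ha, hr⟩ := h
      exact ⟨c • a, by rw [map_smul, mk_smul, ha], by rw [map_smul]; exact hsmul c _ _ hr⟩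
    | mul b b' h h' =>
      obtain ⟨a, ha, hr⟩ := h
      obtain ⟨a', ha', hr'⟩ := h'
      exact ⟨a * a', by rw [map_mul, map_mul, ha, ha'], by rw [map_mul]; exact J.ringCon.mul hr hr'⟩
    | gen g =>
      have hzero : toQuotient K hX hsat (gen K E g) = 0 → gen K E g ∈ J →
          ∃ a : FreeAlg K (E.quotient X hX), toQuotient K hX hsat (gen K E g) = mk K _ a ∧
            J.ringCon (freeLift K (quotientLift K hX) a) (gen K E g) := fun h h' =>
        ⟨0, by rw [h, map_zero], by rw [map_zero]; exact J.ringCon.symm ((J.mem_iff _).1 h')⟩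
      cases g with
      | vertex y =>
        by_cases h : y ∈ X
        · exact hzero ((lift_gen K _ _ _).trans (dif_pos h)) (hJ y h)
        · refine ⟨FreeAlg.of K _ (vertex ⟨y, h⟩), (lift_gen K _ _ _).trans (dif_neg h), ?_⟩
          rw [freeLift_of]
          exact J.ringCon.refl _
      | edge e =>
        by_cases h : E.r e ∈ X
        · exact hzero ((lift_gen K _ _ _).trans (dif_pos h)) (edge_mem K (hJ _ h))
        · refine ⟨FreeAlg.of K _ (edge ⟨e, h⟩), (lift_gen K _ _ _).trans (dif_neg h), ?_⟩
          rw [freeLift_of]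
          exact J.ringCon.refl _
      | ghost e =>
        by_cases h : E.r e ∈ X
        · exact hzero ((lift_gen K _ _ _).trans (dif_pos h)) (ghost_mem K (hJ _ h))
        · refine ⟨FreeAlg.of K _ (ghost ⟨e, h⟩), (lift_gen K _ _ _).trans (dif_neg h), ?_⟩
          rw [freeLift_of]
          exact J.ringCon.refl _
  obtain ⟨a, ha, hr⟩ := key
  have hcon : con K _ a 0 := (mk_eq_mk K).1 (by rw [← ha, hb, map_zero])
  have h := (isLeavittFamily_quotientLift K hX hE J hJ).freeLift_rel hsmul hcon
  rw [map_zero] at h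
  exact (J.mem_iff _).2 (J.ringCon.trans (J.ringCon.symm hr) h)

/-- An ideal that contains the vertices in `H` contains those in the hereditary saturated closure. -/
theorem vertex_mem_of_mem_hereditarySaturatedClosure {H : Set E.Vertex}
    (J : TwoSidedIdeal (LeavittPathAlgebra K E)) (hJ : ∀ y ∈ H, gen K E (vertex y) ∈ J)
    {y : E.Vertex} (hy : y ∈ E.hereditarySaturatedClosure H) : gen K E (vertex y) ∈ J := by
  -- The vertices lying in J form a hereditary saturated set: r(e) = e* s(e) e, and y = ∑ ee* with e
  -- = e r(e).
  refine hy {y | gen K E (vertex y) ∈ J} ⟨hJ, fun e he => ?_, fun y hfin hne hr => ?_⟩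
  · change gen K E (vertex (E.s e)) ∈ J at he
    change gen K E (vertex (E.r e)) ∈ J
    rw [← (isLeavittFamily_gen K E).ghost_mul_edge_self,
      ← (isLeavittFamily_gen K E).source_mul_edge]
    exact J.mul_mem_left _ _ (J.mul_mem_right _ _ he)
  · change gen K E (vertex y) ∈ J
    rw [← (isLeavittFamily_gen K E).sum_edge_mul_ghost y hfin hne]
    refine sum_mem fun e he => J.mul_mem_right _ _ (edge_mem K (hr e ?_))
    simpa using he

end Quotient

end LeavittPathAlgebra

/-! ### The recollement for Leavitt path algebras -/

theorem theorem1 {K : Type u} [Field K] (E : DirectedGraph.{v, w}) (hE : E.RowFinite)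
    (H : Set E.Vertex) (hfin : H.Finite) (hH : E.IsHereditary H) :
    Nonempty (Recollement
      (UnitalModuleCat.{max u v w, max u v w} (LeavittPathAlgebra K
        (E.quotient (E.hereditarySaturatedClosure H)
          (E.isHereditary_hereditarySaturatedClosure H))))
      (UnitalModuleCat.{max u v w, max u v w} (LeavittPathAlgebra K E))
      (UnitalModuleCat.{max u v w, max u v w} (LeavittPathAlgebra K (E.restriction H hH)))) := by
  have : Fintype (E.restriction H hH).Vertex := hfin.fintype
  have hsat := E.isSaturated_hereditarySaturatedClosure H
  refine UnitalModuleCat.nonempty_recollement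
    (LeavittPathAlgebra.ofRestriction K hH : _ →ₙ+* _)
    (LeavittPathAlgebra.ofRestriction_injective K hH)
    (u := LeavittPathAlgebra.vertexSum K (E.restriction H hH) Finset.univ)
    (fun a => (LeavittPathAlgebra.vertexSum_univ_mul a).1)
    (fun a => (LeavittPathAlgebra.vertexSum_univ_mul a).2)
    (LeavittPathAlgebra.exists_ofRestriction_eq K hH)
    (LeavittPathAlgebra.toQuotient K (E.isHereditary_hereditarySaturatedClosure H) hsat : _ →ₙ+* _)
    (LeavittPathAlgebra.toQuotient_surjective K _ hsat) ?_ ?_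
  · change LeavittPathAlgebra.toQuotient K _ hsat (LeavittPathAlgebra.ofRestriction K hH _) = 0
    rw [LeavittPathAlgebra.vertexSum, map_sum, map_sum]
    refine Finset.sum_eq_zero fun y _ => ?_
    rw [LeavittPathAlgebra.ofRestriction_gen]
    exact LeavittPathAlgebra.toQuotient_vertex K _ hsat
      (E.subset_hereditarySaturatedClosure H y.2)
  · intro J hJ a ha
    refine LeavittPathAlgebra.mem_of_toQuotient_eq_zero K _ hE hsat J (fun y hy => ?_) ha
    refine LeavittPathAlgebra.vertex_mem_of_mem_hereditarySaturatedClosure K J (fun y hy => ?_) hy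
    -- An ideal containing ε contains each y = yε with y in H.
    rw [← LeavittPathAlgebra.vertex_mul_cornerUnit K hH hy]
    exact J.mul_mem_left _ _ hJ
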